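/- Fix an alphabet $\Sigma$ (finite or infinite). **Lo-sets and precubes.** A *lo-set* is a finite set $U$ with a strict total order $\dashrightarrow$ and a labelling $\lambda:U\to\Sigma$; an *ilo-set* ${}_SU_T$ is a lo-set $U$ with subsets $S,T\subseteq U$. Let $\mathrm{I}\square$ be the category of isomorphism classes of ilo-sets whose morphisms are *coface maps* $d_{A,B}:{}_{S}U_{T}\to{}_{S'}V_{T'}$: order- and label-preserving maps $\partial:U\to V$ with disjoint $A,B\subseteq V$ such that $\partial(U)=V\setminus(A\cup B)$, $A\cap S'=\emptyset=B\cap T'$, $S=\partial^{-1}(S')$ and $T=\partial^{-1}(T')$. Composition is $d_{C,D}\circ d_{A,B}=d_{\partial(A)\cup C,\,\partial(B)\cup D}$, where $\partial$ is the map underlying $d_{C,D}$. Let $\square$ be the analogous category of lo-sets without interfaces. Write $d^0_A=d_{A,\emptyset}$ and $d^1_B=d_{\emptyset,B}$. **(i)HDAs.** An *HDA* is a presheaf $X$ on $\square$ with finitely many cells (elements of the sets $X[U]$), together with sets $X_\bot$ and $X^\top$ of start and accept cells. An *iHDA* is a presheaf $X$ on $\mathrm{I}\square$ with finitely many cells and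 sets $X_\bot,X^\top$ of cells such that $S=U$ whenever $X_\bot$ contains a cell in $X[{}_SU_T]$ and $T=U$ whenever $X^\top$ contains a cell in $X[{}_SU_T]$. Write $\delta^\nu_A=X[d^\nu_A]$, and $\mathrm{ev}(x)=U$ if $x\in X[U]$ or $x\in X[{}_SU_T]$. **Ipomsets.** A *labelled iposet* $(P,<,\dashrightarrow,S,T,\lambda)$ is a finite set $P$ with two strict partial orders such that any two distinct elements are comparable by $<$ or by $\dashrightarrow$, a labelling $\lambda:P\to\Sigma$, a set $S$ of $<$-minimal elements and a set $T$ of $<$-maximal elements. A *subsumption* $P\to Q$ is a label-preserving bijection $f$ with $f(S_P)=S_Q$ and $f(T_P)=T_Q$ such that $f(x)<_Qf(y)$ implies $x<_Py$, and such that $x\dashrightarrow_Py$ with $x,y$ $<_P$-incomparable implies $f(x)\dashrightarrow_Qf(y)$. It is an *isomorphism* if moreover $x<_Py$ implies $f(x)<_Qf(y)$; thus the event order $\dashrightarrow$ of $<$-comparable elements is immaterial. An *ipomset* is an isomorphism class of labelled iposets; $P\sqsubseteq Q$ means that there is a subsumption $P\to Q$. $P$ is an *interval ipomset* if there are $b,e:P\to\mathbb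 R$ with $b(x)\le e(x)$ for all $x$ and $x<y\iff e(x)<b(y)$ for all $x,y$. An ilo-set ${}_SU_T$ is an ipomset with empty $<$. If the lo-sets $T_P$ and $S_Q$ are isomorphic, the *gluing* $P*Q$ is obtained from $P\sqcup Q$ by identifying $T_P$ with $S_Q$ along the unique isomorphism, with source interface $S_P$, target interface $T_Q$, event order the transitive closure of ${\dashrightarrow_P}\cup{\dashrightarrow_Q}$, and $x<y$ iff $x<_Py$, or $x<_Qy$, or $x\in P\setminus T_P$ and $y\in Q\setminus S_Q$. **Paths and languages.** A *path* in $X$ is a sequence $(x_0,\phi_1,x_1,\dots,\phi_n,x_n)$ of cells $x_k$, over objects $U_k$, such that each $\phi_k$ is either an up-step $d^0_A:U_{k-1}\to U_k$ with $x_{k-1}=\delta^0_A(x_k)$, or a down-step $d^1_B:U_k\to U_{k-1}$ with $x_k=\delta^1_B(x_{k-1})$. An up-step has the ipomset ${}_{V\setminus A}V_V$ with $V=\mathrm{ev}(x_k)$, a down-step the ipomset ${}_{V}V_{V\setminus B}$ with $V=\mathrm{ev}(x_{k-1})$. The event ipomset $\mathrm{ev}(\alpha)$ of a path $\alpha$ is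 the gluing of the ipomsets of its steps, in order, and ${}_VV_V$ with $V=\mathrm{ev}(x_0)$ if $\alpha=(x_0)$. A path is *accepting* if $x_0\in X_\bot$ and $x_n\in X^\top$, and $\mathrm{Lang}(X)=\{\mathrm{ev}(\alpha)\mid\alpha\text{ is an accepting path in }X\}$. **Proposition.** For every HDA and every iHDA $X$, $\mathrm{Lang}(X)$ is a language: every element of $\mathrm{Lang}(X)$ is an interval ipomset, and if $P$ is an interval ipomset, $Q\in\mathrm{Lang}(X)$ and $P\sqsubseteq Q$, then $P\in\mathrm{Lang}(X)$. -/

import Mathlib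

open CategoryTheory Opposite

universe v w

/-! ### Labelled precube categories -/

/-- A word over the alphabet `Act`, viewed as the lo-set `0 < 1 < ... < n - 1` labelled by `lab`.
These represent the isomorphism classes of lo-sets and are the objects of `□`. -/
structure LoWord (Act : Type v) where
  n : ℕ
  lab : Fin n → Act

/-- A coface map `d_{A,B} : U → V`: the lo-map `∂_{A ∪ B}`, with image the complement of `A ∪ B`,
the set `A` of unstarted events and the set `B` of terminated events. -/
@[ext]
structure Coface {Act : Type v} (U V : LoWord Act) where
  emb : Fin U.n ↪o Fin V.n
  lab_emb : ∀ i, V.lab (emb i) = U.lab i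
  A : Set (Fin V.n)
  B : Set (Fin V.n)
  disj : Disjoint A B
  range_emb : Set.range emb = (A ∪ B)ᶜ

namespace Coface

variable {Act : Type v} {U V W : LoWord Act}

theorem emb_notMem_A (d : Coface U V) (i : Fin U.n) : d.emb i ∉ d.A := fun h => by
  have : d.emb i ∈ (d.A ∪ d.B)ᶜ := d.range_emb ▸ Set.mem_range_self i
  exact this (Or.inl h)

theorem emb_notMem_B (d : Coface U V) (i : Fin U.n) : d.emb i ∉ d.B := fun h => by
  have : d.emb i ∈ (d.A ∪ d.B)ᶜ := d.range_emb ▸ Set.mem_range_self i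
  exact this (Or.inr h)

theorem exists_emb (d : Coface U V) (j : Fin V.n) (hA : j ∉ d.A) (hB : j ∉ d.B) :
    ∃ i, d.emb i = j := by
  have : j ∈ Set.range d.emb := by
    rw [d.range_emb]; rintro (h | h) <;> contradiction
  exact this

/-- The identity `d_{∅,∅}`. -/
def id (U : LoWord Act) : Coface U U where
  emb := RelEmbedding.refl _
  lab_emb _ := rfl
  A := ∅
  B := ∅
  disj := disjoint_bot_left
  range_emb := by ext x; simp

/-- `d_{C,D} ∘ d_{A,B} = d_{∂(A) ∪ C, ∂(B) ∪ D}` with `∂ = ∂_{C ∪ D}`. -/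
def comp (d : Coface U V) (e : Coface V W) : Coface U W where
  emb := d.emb.trans e.emb
  lab_emb i := (e.lab_emb _).trans (d.lab_emb i)
  A := e.emb '' d.A ∪ e.A
  B := e.emb '' d.B ∪ e.B
  disj := by
    rw [Set.disjoint_left]
    rintro _ (⟨i, hi, rfl⟩ | hx) (⟨j, hj, hji⟩ | hy)
    · rw [e.emb.injective hji] at hj
      exact Set.disjoint_left.1 d.disj hi hj
    · exact e.emb_notMem_B i hy
    · exact e.emb_notMem_A j (hji ▸ hx)
    · exact Set.disjoint_left.1 e.disj hx hy
  range_emb := by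
    ext x
    constructor
    · rintro ⟨i, rfl⟩
      rintro ((⟨j, hj, hji⟩ | h) | (⟨j, hj, hji⟩ | h))
      · exact d.emb_notMem_A i (e.emb.injective hji ▸ hj)
      · exact e.emb_notMem_A _ h
      · exact d.emb_notMem_B i (e.emb.injective hji ▸ hj)
      · exact e.emb_notMem_B _ h
    · intro hx
      obtain ⟨j, rfl⟩ := e.exists_emb x (fun h => hx (Or.inl (Or.inr h)))
        (fun h => hx (Or.inr (Or.inr h)))
      obtain ⟨i, rfl⟩ := d.exists_emb j (fun h => hx (Or.inl (Or.inl ⟨j, h, rfl⟩)))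
        (fun h => hx (Or.inr (Or.inl ⟨j, h, rfl⟩)))
      exact ⟨i, rfl⟩

end Coface

/-- The labelled precube category `□`. -/
instance LoWord.category (Act : Type v) : Category.{0} (LoWord Act) where
  Hom := Coface
  id := Coface.id
  comp := Coface.comp
  id_comp d := by
    refine Coface.ext ?_ ?_ ?_
    · ext i; rfl
    · simp [Coface.comp, Coface.id]
    · simp [Coface.comp, Coface.id]
  comp_id d := by
    refine Coface.ext ?_ ?_ ?_
    · ext i; rfl
    · ext x; simp [Coface.comp, Coface.id]
    · ext x; simp [Coface.comp, Coface.id]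
  assoc d e f := by
    refine Coface.ext ?_ ?_ ?_
    · ext i; rfl
    · simp [Coface.comp, Set.image_union, Set.image_image, Set.union_assoc]
    · simp [Coface.comp, Set.image_union, Set.image_image, Set.union_assoc]

/-- A lo-set with source interface `S` and target interface `T`, on a word over `Act`.
These represent the isomorphism classes of ilo-sets and are the objects of `I□`. -/
structure IloWord (Act : Type v) where
  lo : LoWord Act
  S : Set (Fin lo.n)
  T : Set (Fin lo.n)

/-- A coface map of ilo-sets. -/
@[ext]
structure ICoface {Act : Type v} (U V : IloWord Act) where
  base : Coface U.lo V.lo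
  preimage_S : U.S = base.emb ⁻¹' V.S
  preimage_T : U.T = base.emb ⁻¹' V.T
  disj_S : Disjoint base.A V.S
  disj_T : Disjoint base.B V.T

/-- The labelled precube category with interfaces `I□`. -/
instance IloWord.category (Act : Type v) : Category.{0} (IloWord Act) where
  Hom := ICoface
  id U :=
    { base := Coface.id U.lo
      preimage_S := rfl
      preimage_T := rfl
      disj_S := disjoint_bot_left
      disj_T := disjoint_bot_left }
  comp {U V W} d e :=
    { base := d.base.comp e.base
      preimage_S := by rw [d.preimage_S, e.preimage_S]; rfl
      preimage_T := by rw [d.preimage_T, e.preimage_T]; rfl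
      disj_S := by
        rw [Set.disjoint_left]
        rintro _ (⟨i, hi, rfl⟩ | hx) hS
        · refine Set.disjoint_left.1 d.disj_S hi ?_
          rw [e.preimage_S]; exact hS
        · exact Set.disjoint_left.1 e.disj_S hx hS
      disj_T := by
        rw [Set.disjoint_left]
        rintro _ (⟨i, hi, rfl⟩ | hx) hT
        · refine Set.disjoint_left.1 d.disj_T hi ?_
          rw [e.preimage_T]; exact hT
        · exact Set.disjoint_left.1 e.disj_T hx hT }
  id_comp d := ICoface.ext (Category.id_comp (X := LoWord.mk _ _) (Y := LoWord.mk _ _) d.base)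
  comp_id d := ICoface.ext (Category.comp_id (X := LoWord.mk _ _) (Y := LoWord.mk _ _) d.base)
  assoc d e f := ICoface.ext (Category.assoc (W := LoWord.mk _ _) (X := LoWord.mk _ _)
    (Y := LoWord.mk _ _) (Z := LoWord.mk _ _) d.base e.base f.base)

/-- The functor `I□ → □` that forgets the interfaces. -/
def IloWord.forget (Act : Type v) : IloWord Act ⥤ LoWord Act where
  obj U := U.lo
  map d := d.base

/-! ### Higher-dimensional automata -/

/-- The cells of a presheaf. -/
abbrev Cell {C : Type v} [Category.{0} C] (X : Cᵒᵖ ⥤ Type w) : Type (max v w) :=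
  Σ U : C, X.obj (op U)

/-- A higher-dimensional automaton over the alphabet `Act`. -/
structure HDA (Act : Type v) where
  X : (LoWord Act)ᵒᵖ ⥤ Type w
  finite : Finite (Cell X)
  start : Set (Cell X)
  accept : Set (Cell X)

/-- A higher-dimensional automaton with interfaces over the alphabet `Act`. -/
structure IHDA (Act : Type v) where
  X : (IloWord Act)ᵒᵖ ⥤ Type w
  finite : Finite (Cell X)
  start : Set (Cell X)
  accept : Set (Cell X)
  start_S : ∀ x ∈ start, x.1.S = Set.univ
  accept_T : ∀ x ∈ accept, x.1.T = Set.univ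

/-! ### Ipomsets -/

/-- A labelled iposet: precedence order `prec`, event order `evt`, interfaces `S` and `T`. -/
structure Iposet (Act : Type v) where
  carrier : Type
  finite : Finite carrier
  prec : carrier → carrier → Prop
  evt : carrier → carrier → Prop
  S : Set carrier
  T : Set carrier
  lab : carrier → Act
  prec_irrefl : ∀ x, ¬ prec x x
  prec_trans : ∀ x y z, prec x y → prec y z → prec x z
  evt_irrefl : ∀ x, ¬ evt x x
  evt_trans : ∀ x y z, evt x y → evt y z → evt x z
  comparable : ∀ x y, x = y ∨ prec x y ∨ prec y x ∨ evt x y ∨ evt y x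
  S_minimal : ∀ x ∈ S, ∀ y, ¬ prec y x
  T_maximal : ∀ x ∈ T, ∀ y, ¬ prec x y

namespace Iposet

variable {Act : Type v}

/-- The bijection `f` is a subsumption from `P` to `Q`. -/
structure IsSubsumption (P Q : Iposet Act) (f : P.carrier ≃ Q.carrier) : Prop where
  lab : ∀ x, Q.lab (f x) = P.lab x
  image_S : f '' P.S = Q.S
  image_T : f '' P.T = Q.T
  reflects_prec : ∀ x y, Q.prec (f x) (f y) → P.prec x y
  preserves_evt : ∀ x y, P.evt x y → ¬ P.prec x y → ¬ P.prec y x → Q.evt (f x) (f y)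

/-- `P ⊑ Q`: there is a subsumption from `P` to `Q`. -/
def Subsumed (P Q : Iposet Act) : Prop := ∃ f, IsSubsumption P Q f

/-- `P ≅ Q`: there is a subsumption from `P` to `Q` that is an isomorphism for the precedence
orders. It then preserves and reflects the event order of incomparable elements (see `Iso.symm`);
the event order of elements that are already ordered by precedence is immaterial. -/
def Iso (P Q : Iposet Act) : Prop :=
  ∃ f, IsSubsumption P Q f ∧ ∀ x y, P.prec x y ↔ Q.prec (f x) (f y)

theorem IsSubsumption.comp {P Q R : Iposet Act} {f : P.carrier ≃ Q.carrier}
    {g : Q.carrier ≃ R.carrier} (hf : IsSubsumption P Q f) (hg : IsSubsumption Q R g) :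
    IsSubsumption P R (f.trans g) where
  lab x := (hg.lab _).trans (hf.lab x)
  image_S := by rw [← hg.image_S, ← hf.image_S, Set.image_image]; rfl
  image_T := by rw [← hg.image_T, ← hf.image_T, Set.image_image]; rfl
  reflects_prec x y h := hf.reflects_prec x y (hg.reflects_prec _ _ h)
  preserves_evt x y h h1 h2 := hg.preserves_evt _ _ (hf.preserves_evt x y h h1 h2)
    (fun h => h1 (hf.reflects_prec _ _ h)) (fun h => h2 (hf.reflects_prec _ _ h))

theorem Subsumed.trans {P Q R : Iposet Act} (h : P.Subsumed Q) (h' : Q.Subsumed R) :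
    P.Subsumed R := by
  obtain ⟨f, hf⟩ := h
  obtain ⟨g, hg⟩ := h'
  exact ⟨_, hf.comp hg⟩

theorem Iso.subsumed {P Q : Iposet Act} (h : P.Iso Q) : P.Subsumed Q := by
  obtain ⟨f, hf, -⟩ := h
  exact ⟨f, hf⟩

theorem Iso.refl (P : Iposet Act) : P.Iso P :=
  ⟨Equiv.refl _, ⟨fun _ => rfl, by simp, by simp, fun _ _ h => h, fun _ _ h _ _ => h⟩,
    fun _ _ => Iff.rfl⟩

theorem Iso.symm {P Q : Iposet Act} (h : P.Iso Q) : Q.Iso P := by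
  obtain ⟨f, hf, hp⟩ := h
  have hp' : ∀ x y, Q.prec x y ↔ P.prec (f.symm x) (f.symm y) := fun x y => by simp [hp]
  refine ⟨f.symm, ⟨fun x => ?_, ?_, ?_, fun x y h => (hp' x y).2 h, fun x y h h1 h2 => ?_⟩, hp'⟩
  · rw [← hf.lab]; simp
  · rw [← hf.image_S]; simp
  · rw [← hf.image_T]; simp
  · rw [hp'] at h1 h2
    rcases P.comparable (f.symm x) (f.symm y) with e | e | e | e | e
    · rw [f.symm.injective e] at h; exact (Q.evt_irrefl _ h).elim
    · exact (h1 e).elim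
    · exact (h2 e).elim
    · exact e
    · have := hf.preserves_evt _ _ e h2 h1
      simp only [Equiv.apply_symm_apply] at this
      exact (Q.evt_irrefl _ (Q.evt_trans _ _ _ h this)).elim

theorem Iso.trans {P Q R : Iposet Act} (h : P.Iso Q) (h' : Q.Iso R) : P.Iso R := by
  obtain ⟨f, hf, hp⟩ := h
  obtain ⟨g, hg, hq⟩ := h'
  exact ⟨_, hf.comp hg, fun x y => (hp x y).trans (hq _ _)⟩

/-- `P` admits an interval representation. -/
def IsInterval (P : Iposet Act) : Prop :=
  ∃ b e : P.carrier → ℝ, (∀ x, b x ≤ e x) ∧ ∀ x y, P.prec x y ↔ e x < b y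

theorem Iso.isInterval {P Q : Iposet Act} (h : P.Iso Q) (hP : P.IsInterval) : Q.IsInterval := by
  obtain ⟨f, -, hp⟩ := h.symm
  obtain ⟨b, e, hbe, hpe⟩ := hP
  exact ⟨b ∘ f, e ∘ f, fun x => hbe _, fun x y => (hp x y).trans (hpe _ _)⟩

instance setoid (Act : Type v) : Setoid (Iposet Act) where
  r := Iso
  iseqv := ⟨Iso.refl, Iso.symm, Iso.trans⟩

end Iposet

/-- Ipomsets: isomorphism classes of labelled iposets. -/
def Ipomset (Act : Type v) : Type (max v 1) := Quotient (Iposet.setoid Act)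

namespace Ipomset

variable {Act : Type v}

/-- The ipomset of a labelled iposet. -/
def mk (P : Iposet Act) : Ipomset Act := Quotient.mk _ P

/-- Subsumption of ipomsets. -/
def Subsumed : Ipomset Act → Ipomset Act → Prop :=
  Quotient.lift₂ Iposet.Subsumed fun _ _ _ _ h h' => propext
    ⟨fun k => (Iposet.Iso.subsumed (Iposet.Iso.symm h)).trans (k.trans (Iposet.Iso.subsumed h')),
     fun k => (Iposet.Iso.subsumed h).trans
       (k.trans (Iposet.Iso.subsumed (Iposet.Iso.symm h')))⟩

/-- Interval ipomsets. -/
def IsInterval : Ipomset Act → Prop :=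
  Quotient.lift Iposet.IsInterval fun _ _ h => propext
    ⟨Iposet.Iso.isInterval h, Iposet.Iso.isInterval (Iposet.Iso.symm h)⟩

/-- A language: a set of interval ipomsets that is down-closed, among the interval ipomsets,
under subsumption. -/
def IsLanguage (L : Set (Ipomset Act)) : Prop :=
  (∀ P ∈ L, P.IsInterval) ∧
    ∀ P Q : Ipomset Act, P.IsInterval → P.Subsumed Q → Q ∈ L → P ∈ L

end Ipomset

/-! ### Gluing composition -/

namespace Iposet

variable {Act : Type v}

/-- An isomorphism of lo-sets from the target interface of `P` to the source interface of `Q`. -/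
structure InterfaceIso (P Q : Iposet Act) where
  toEquiv : {x // x ∈ P.T} ≃ {y // y ∈ Q.S}
  evt_iff : ∀ x y, Q.evt (toEquiv x) (toEquiv y) ↔ P.evt x y
  lab_eq : ∀ x, Q.lab (toEquiv x) = P.lab x

namespace InterfaceIso

variable {P Q : Iposet Act} (f : InterfaceIso P Q)

/-- The carrier of the gluing. Every class of the quotient of `P ⊔ Q` by `x ≡ f x` has exactly
one representative that lies in `P` or in `Q ∖ S_Q`; `inl` and `inr` are the structural maps. -/
abbrev Carrier (_ : InterfaceIso P Q) : Type := P.carrier ⊕ {y : Q.carrier // y ∉ Q.S}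

/-- The structural map from `P` to the gluing. -/
def inl (x : P.carrier) : f.Carrier := Sum.inl x

open Classical in
/-- The structural map from `Q` to the gluing; it identifies `f x` with `x`. -/
noncomputable def inr (y : Q.carrier) : f.Carrier :=
  if h : y ∈ Q.S then Sum.inl (f.toEquiv.symm ⟨y, h⟩ : P.carrier) else Sum.inr ⟨y, h⟩

theorem inl_injective : Function.Injective f.inl := Sum.inl_injective

theorem inl_eq_inr {x : P.carrier} {y : Q.carrier} :
    f.inl x = f.inr y ↔ ∃ h : x ∈ P.T, (f.toEquiv ⟨x, h⟩ : Q.carrier) = y := by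
  unfold inl inr
  split_ifs with hy
  · constructor
    · intro h
      have := Sum.inl_injective h
      subst this
      exact ⟨(f.toEquiv.symm ⟨y, hy⟩).2, by simp⟩
    · rintro ⟨h, rfl⟩
      simp
  · simp only [false_iff]
    rintro ⟨h, rfl⟩
    exact hy (f.toEquiv ⟨x, h⟩).2

theorem inr_injective : Function.Injective f.inr := by
  intro x y h
  by_cases hx : x ∈ Q.S
  · have h1 : f.inl (f.toEquiv.symm ⟨x, hx⟩ : P.carrier) = f.inr x :=
      f.inl_eq_inr.2 ⟨(f.toEquiv.symm ⟨x, hx⟩).2, by simp⟩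
    obtain ⟨_, h2⟩ := f.inl_eq_inr.1 (h1.trans h)
    rw [← h2]; simp
  · by_cases hy : y ∈ Q.S
    · simp [inr, hx, hy] at h
    · simpa [inr, hx, hy] using h

theorem cases (z : f.Carrier) : (∃ x, z = f.inl x) ∨ ∃ y, y ∉ Q.S ∧ z = f.inr y := by
  rcases z with x | ⟨y, hy⟩
  · exact Or.inl ⟨x, rfl⟩
  · exact Or.inr ⟨y, hy, by simp [inr, hy]⟩

/-- The precedence order of the gluing. -/
inductive Prec : f.Carrier → f.Carrier → Prop
  | left {x y : P.carrier} : P.prec x y → Prec (f.inl x) (f.inl y)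
  | right {x y : Q.carrier} : Q.prec x y → Prec (f.inr x) (f.inr y)
  | cross {x : P.carrier} {y : Q.carrier} : x ∉ P.T → y ∉ Q.S → Prec (f.inl x) (f.inr y)

/-- The union of the event orders of `P` and `Q`, in the gluing. -/
inductive Evt₀ : f.Carrier → f.Carrier → Prop
  | left {x y : P.carrier} : P.evt x y → Evt₀ (f.inl x) (f.inl y)
  | right {x y : Q.carrier} : Q.evt x y → Evt₀ (f.inr x) (f.inr y)

/-- The event order of the gluing. -/
def Evt : f.Carrier → f.Carrier → Prop := Relation.TransGen f.Evt₀

theorem prec_iff {a b : f.Carrier} : f.Prec a b ↔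
    (∃ x y, a = f.inl x ∧ b = f.inl y ∧ P.prec x y) ∨
    (∃ x y, a = f.inr x ∧ b = f.inr y ∧ Q.prec x y) ∨
    (∃ x y, a = f.inl x ∧ b = f.inr y ∧ x ∉ P.T ∧ y ∉ Q.S) := by
  constructor
  · rintro (h | h | ⟨h, h'⟩)
    · exact Or.inl ⟨_, _, rfl, rfl, h⟩
    · exact Or.inr (Or.inl ⟨_, _, rfl, rfl, h⟩)
    · exact Or.inr (Or.inr ⟨_, _, rfl, rfl, h, h'⟩)
  · rintro (⟨x, y, rfl, rfl, h⟩ | ⟨x, y, rfl, rfl, h⟩ | ⟨x, y, rfl, rfl, h, h'⟩)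
    · exact .left h
    · exact .right h
    · exact .cross h h'

theorem prec_irrefl (a : f.Carrier) : ¬ f.Prec a a := by
  rw [prec_iff]
  rintro (⟨x, y, rfl, hb, h⟩ | ⟨x, y, rfl, hb, h⟩ | ⟨x, y, rfl, hb, h, h'⟩)
  · rw [f.inl_injective hb] at h; exact P.prec_irrefl _ h
  · rw [f.inr_injective hb] at h; exact Q.prec_irrefl _ h
  · obtain ⟨k, -⟩ := f.inl_eq_inr.1 hb; exact h k

theorem prec_trans (a b c : f.Carrier) (hab : f.Prec a b) (hbc : f.Prec b c) : f.Prec a c := by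
  rw [prec_iff] at hab hbc
  rcases hab with ⟨x, y, rfl, rfl, h⟩ | ⟨x, y, rfl, rfl, h⟩ | ⟨x, y, rfl, rfl, h, h'⟩ <;>
  rcases hbc with ⟨x', z, e, rfl, k⟩ | ⟨x', z, e, rfl, k⟩ | ⟨x', z, e, rfl, k, k'⟩
  · rw [← f.inl_injective e] at k; exact .left (P.prec_trans _ _ _ h k)
  · exact .cross (fun hx => P.T_maximal _ hx _ h) (fun hz => Q.S_minimal _ hz _ k)
  · exact .cross (fun hx => P.T_maximal _ hx _ h) k'
  · obtain ⟨hT, rfl⟩ := f.inl_eq_inr.1 e.symm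
    exact (Q.S_minimal _ (f.toEquiv ⟨x', hT⟩).2 _ h).elim
  · rw [← f.inr_injective e] at k; exact .right (Q.prec_trans _ _ _ h k)
  · obtain ⟨hT, -⟩ := f.inl_eq_inr.1 e.symm; exact (k hT).elim
  · obtain ⟨hT, rfl⟩ := f.inl_eq_inr.1 e.symm
    exact (h' (f.toEquiv ⟨x', hT⟩).2).elim
  · exact .cross h (fun hz => Q.S_minimal _ hz _ k)
  · exact .cross h k'

theorem evt_cases {a b : f.Carrier} (h : f.Evt a b) :
    (∃ x y, a = f.inl x ∧ b = f.inl y ∧ P.evt x y) ∨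
    (∃ x y, a = f.inr x ∧ b = f.inr y ∧ Q.evt x y) ∨
    (∃ x y, ∃ t : {x // x ∈ P.T}, a = f.inl x ∧ b = f.inr y ∧ P.evt x t ∧
      Q.evt (f.toEquiv t) y) ∨
    (∃ x y, ∃ t : {x // x ∈ P.T}, a = f.inr x ∧ b = f.inl y ∧ Q.evt x (f.toEquiv t) ∧
      P.evt t y) := by
  induction h with
  | single h =>
    rcases h with h | h
    · exact Or.inl ⟨_, _, rfl, rfl, h⟩
    · exact Or.inr (Or.inl ⟨_, _, rfl, rfl, h⟩)
  | tail _ h ih =>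
    rcases ih with ⟨x, y, rfl, hb, k⟩ | ⟨x, y, rfl, hb, k⟩ | ⟨x, y, t, rfl, hb, k, l⟩ |
      ⟨x, y, t, rfl, hb, k, l⟩ <;>
    rcases h with h | h
    · rw [f.inl_injective hb] at h
      exact Or.inl ⟨_, _, rfl, rfl, P.evt_trans _ _ _ k h⟩
    · obtain ⟨hT, rfl⟩ := f.inl_eq_inr.1 hb.symm
      exact Or.inr (Or.inr (Or.inl ⟨_, _, ⟨y, hT⟩, rfl, rfl, k, h⟩))
    · obtain ⟨hT, rfl⟩ := f.inl_eq_inr.1 hb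
      exact Or.inr (Or.inr (Or.inr ⟨_, _, ⟨_, hT⟩, rfl, rfl, k, h⟩))
    · rw [f.inr_injective hb] at h
      exact Or.inr (Or.inl ⟨_, _, rfl, rfl, Q.evt_trans _ _ _ k h⟩)
    · obtain ⟨hT, rfl⟩ := f.inl_eq_inr.1 hb
      exact Or.inl ⟨_, _, rfl, rfl,
        P.evt_trans _ _ _ (P.evt_trans _ _ _ k ((f.evt_iff _ _).1 l)) h⟩
    · rw [f.inr_injective hb] at h
      exact Or.inr (Or.inr (Or.inl ⟨_, _, t, rfl, rfl, k, Q.evt_trans _ _ _ l h⟩))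
    · rw [f.inl_injective hb] at h
      exact Or.inr (Or.inr (Or.inr ⟨_, _, t, rfl, rfl, k, P.evt_trans _ _ _ l h⟩))
    · obtain ⟨hT, rfl⟩ := f.inl_eq_inr.1 hb.symm
      exact Or.inr (Or.inl ⟨_, _, rfl, rfl, Q.evt_trans _ _ _
        (Q.evt_trans _ _ _ k ((f.evt_iff t ⟨y, hT⟩).2 l)) h⟩)

theorem evt_irrefl (a : f.Carrier) : ¬ f.Evt a a := by
  intro h
  rcases f.evt_cases h with ⟨x, y, rfl, hb, k⟩ | ⟨x, y, rfl, hb, k⟩ | ⟨x, y, t, rfl, hb, k, l⟩ |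
      ⟨x, y, t, rfl, hb, k, l⟩
  · rw [f.inl_injective hb] at k; exact P.evt_irrefl _ k
  · rw [f.inr_injective hb] at k; exact Q.evt_irrefl _ k
  · obtain ⟨hT, rfl⟩ := f.inl_eq_inr.1 hb
    exact P.evt_irrefl _ (P.evt_trans _ _ _ k ((f.evt_iff t ⟨x, hT⟩).1 l))
  · obtain ⟨hT, rfl⟩ := f.inl_eq_inr.1 hb.symm
    exact P.evt_irrefl _ (P.evt_trans _ _ _ ((f.evt_iff ⟨y, hT⟩ t).1 k) l)

theorem evt_inl_iff {x y : P.carrier} : f.Evt (f.inl x) (f.inl y) ↔ P.evt x y := by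
  refine ⟨fun h => ?_, fun h => .single (.left h)⟩
  rcases f.evt_cases h with ⟨x', y', ha, hb, k⟩ | ⟨x', y', ha, hb, k⟩ |
    ⟨x', y', t, ha, hb, k, l⟩ | ⟨x', y', t, ha, hb, k, l⟩
  · rwa [f.inl_injective ha, f.inl_injective hb]
  · obtain ⟨h1, rfl⟩ := f.inl_eq_inr.1 ha
    obtain ⟨h2, rfl⟩ := f.inl_eq_inr.1 hb
    exact (f.evt_iff _ _).1 k
  · obtain ⟨h2, rfl⟩ := f.inl_eq_inr.1 hb
    rw [f.inl_injective ha]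
    exact P.evt_trans _ _ _ k ((f.evt_iff t ⟨y, h2⟩).1 l)
  · obtain ⟨h1, rfl⟩ := f.inl_eq_inr.1 ha
    rw [f.inl_injective hb]
    exact P.evt_trans _ _ _ ((f.evt_iff ⟨x, h1⟩ t).1 k) l

theorem evt_inr_iff {x y : Q.carrier} : f.Evt (f.inr x) (f.inr y) ↔ Q.evt x y := by
  refine ⟨fun h => ?_, fun h => .single (.right h)⟩
  rcases f.evt_cases h with ⟨x', y', ha, hb, k⟩ | ⟨x', y', ha, hb, k⟩ |
    ⟨x', y', t, ha, hb, k, l⟩ | ⟨x', y', t, ha, hb, k, l⟩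
  · obtain ⟨h1, rfl⟩ := f.inl_eq_inr.1 ha.symm
    obtain ⟨h2, rfl⟩ := f.inl_eq_inr.1 hb.symm
    exact (f.evt_iff ⟨x', h1⟩ ⟨y', h2⟩).2 k
  · rwa [f.inr_injective ha, f.inr_injective hb]
  · obtain ⟨h1, rfl⟩ := f.inl_eq_inr.1 ha.symm
    rw [f.inr_injective hb]
    exact Q.evt_trans _ _ _ ((f.evt_iff ⟨x', h1⟩ t).2 k) l
  · obtain ⟨h2, rfl⟩ := f.inl_eq_inr.1 hb.symm
    rw [f.inr_injective ha]
    exact Q.evt_trans _ _ _ k ((f.evt_iff t ⟨y', h2⟩).2 l)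

/-- The labelling of the gluing. -/
def lab : f.Carrier → Act := Sum.elim P.lab fun y => Q.lab y

theorem lab_inr (y : Q.carrier) : f.lab (f.inr y) = Q.lab y := by
  unfold lab inr
  split_ifs with h
  · simp [← f.lab_eq]
  · rfl

end InterfaceIso

/-- The gluing composition `P * Q` along the isomorphism `f : T_P ≃ S_Q`. -/
noncomputable def glue (P Q : Iposet Act) (f : InterfaceIso P Q) : Iposet Act where
  carrier := f.Carrier
  finite := by
    have := P.finite
    have := Q.finite
    exact inferInstanceAs (Finite (P.carrier ⊕ {y : Q.carrier // y ∉ Q.S}))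
  prec := f.Prec
  evt := f.Evt
  S := f.inl '' P.S
  T := f.inr '' Q.T
  lab := f.lab
  prec_irrefl := f.prec_irrefl
  prec_trans := f.prec_trans
  evt_irrefl := f.evt_irrefl
  evt_trans _ _ _ := Relation.TransGen.trans
  comparable a b := by
    have hPP : ∀ x y, f.inl x = f.inl y ∨ f.Prec (f.inl x) (f.inl y) ∨
        f.Prec (f.inl y) (f.inl x) ∨ f.Evt (f.inl x) (f.inl y) ∨ f.Evt (f.inl y) (f.inl x) := by
      intro x y
      rcases P.comparable x y with h | h | h | h | h
      · exact Or.inl (congrArg _ h)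
      · exact Or.inr (Or.inl (.left h))
      · exact Or.inr (Or.inr (Or.inl (.left h)))
      · exact Or.inr (Or.inr (Or.inr (Or.inl (.single (.left h)))))
      · exact Or.inr (Or.inr (Or.inr (Or.inr (.single (.left h)))))
    have hQQ : ∀ x y, f.inr x = f.inr y ∨ f.Prec (f.inr x) (f.inr y) ∨
        f.Prec (f.inr y) (f.inr x) ∨ f.Evt (f.inr x) (f.inr y) ∨ f.Evt (f.inr y) (f.inr x) := by
      intro x y
      rcases Q.comparable x y with h | h | h | h | h
      · exact Or.inl (congrArg _ h)
      · exact Or.inr (Or.inl (.right h))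
      · exact Or.inr (Or.inr (Or.inl (.right h)))
      · exact Or.inr (Or.inr (Or.inr (Or.inl (.single (.right h)))))
      · exact Or.inr (Or.inr (Or.inr (Or.inr (.single (.right h)))))
    rcases f.cases a with ⟨x, rfl⟩ | ⟨x, hx, rfl⟩ <;>
    rcases f.cases b with ⟨y, rfl⟩ | ⟨y, hy, rfl⟩
    · exact hPP x y
    · by_cases hT : x ∈ P.T
      · rw [f.inl_eq_inr.2 ⟨hT, rfl⟩]; exact hQQ _ _
      · exact Or.inr (Or.inl (.cross hT hy))
    · by_cases hT : y ∈ P.T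
      · rw [f.inl_eq_inr.2 ⟨hT, rfl⟩]; exact hQQ _ _
      · exact Or.inr (Or.inr (Or.inl (.cross hT hx)))
    · exact hQQ x y
  S_minimal := by
    rintro _ ⟨x, hx, rfl⟩ b h
    rw [f.prec_iff] at h
    rcases h with ⟨x', y, rfl, hb, h⟩ | ⟨x', y, rfl, hb, h⟩ | ⟨x', y, rfl, hb, h, h'⟩
    · rw [← f.inl_injective hb] at h; exact P.S_minimal _ hx _ h
    · obtain ⟨hT, rfl⟩ := f.inl_eq_inr.1 hb
      exact Q.S_minimal _ (f.toEquiv ⟨x, hT⟩).2 _ h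
    · obtain ⟨hT, rfl⟩ := f.inl_eq_inr.1 hb
      exact h' (f.toEquiv ⟨x, hT⟩).2
  T_maximal := by
    rintro _ ⟨x, hx, rfl⟩ b h
    rw [f.prec_iff] at h
    rcases h with ⟨x', y, hb, rfl, h⟩ | ⟨x', y, hb, rfl, h⟩ | ⟨x', y, hb, rfl, h, h'⟩
    · obtain ⟨hT, -⟩ := f.inl_eq_inr.1 hb.symm
      exact P.T_maximal _ hT _ h
    · rw [← f.inr_injective hb] at h; exact Q.T_maximal _ hx _ h
    · obtain ⟨hT, -⟩ := f.inl_eq_inr.1 hb.symm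
      exact h hT

/-- The discrete iposet `_S U_T` on a word `U`; its event order is the order of `U`. -/
def discrete (U : LoWord Act) (S T : Set (Fin U.n)) : Iposet Act where
  carrier := Fin U.n
  finite := inferInstance
  prec _ _ := False
  evt i j := i < j
  S := S
  T := T
  lab := U.lab
  prec_irrefl _ h := h
  prec_trans _ _ _ h _ := h
  evt_irrefl := lt_irrefl
  evt_trans _ _ _ := lt_trans
  comparable i j := by
    rcases lt_trichotomy i j with h | h | h <;> simp [h]
  S_minimal _ _ _ h := h
  T_maximal _ _ _ h := h

/-- `e` is an isomorphism from the lo-set `U` to the subset `I` of `P`. -/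
structure IsLoIso (P : Iposet Act) (I : Set P.carrier) (U : LoWord Act)
    (e : Fin U.n ≃ {x // x ∈ I}) : Prop where
  evt_iff : ∀ i j, P.evt (e i) (e j) ↔ i < j
  lab_eq : ∀ i, P.lab (e i) = U.lab i

/-- An iposet whose source and target interfaces are identified with `U` and `V`. -/
structure Between (U V : LoWord Act) where
  P : Iposet Act
  src : Fin U.n ≃ {x // x ∈ P.S}
  tgt : Fin V.n ≃ {x // x ∈ P.T}
  src_iso : IsLoIso P P.S U src
  tgt_iso : IsLoIso P P.T V tgt

namespace Between

variable {U V W : LoWord Act}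

/-- The isomorphism from the target interface of `P` to the source interface of `Q`. -/
def interfaceIso (P : Between U V) (Q : Between V W) : InterfaceIso P.P Q.P where
  toEquiv := P.tgt.symm.trans Q.src
  evt_iff x y := by
    rw [Equiv.trans_apply, Equiv.trans_apply, Q.src_iso.evt_iff, ← P.tgt_iso.evt_iff]
    simp
  lab_eq x := by
    rw [Equiv.trans_apply, Q.src_iso.lab_eq, ← P.tgt_iso.lab_eq]
    simp

/-- Gluing, with the interfaces of the result identified in the evident way. -/
noncomputable def glue (P : Between U V) (Q : Between V W) : Between U W where
  P := Iposet.glue P.P Q.P (P.interfaceIso Q)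
  src := P.src.trans (Equiv.Set.image _ P.P.S (P.interfaceIso Q).inl_injective)
  tgt := Q.tgt.trans (Equiv.Set.image _ Q.P.T (P.interfaceIso Q).inr_injective)
  src_iso :=
    { evt_iff := fun i j => (P.interfaceIso Q).evt_inl_iff.trans (P.src_iso.evt_iff i j)
      lab_eq := fun i => P.src_iso.lab_eq i }
  tgt_iso :=
    { evt_iff := fun i j => (P.interfaceIso Q).evt_inr_iff.trans (Q.tgt_iso.evt_iff i j)
      lab_eq := fun i => ((P.interfaceIso Q).lab_inr _).trans (Q.tgt_iso.lab_eq i) }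

/-- The identity iposet `_U U_U`. -/
def id (U : LoWord Act) : Between U U where
  P := discrete U Set.univ Set.univ
  src := (Equiv.Set.univ _).symm
  tgt := (Equiv.Set.univ _).symm
  src_iso := ⟨fun _ _ => Iff.rfl, fun _ => rfl⟩
  tgt_iso := ⟨fun _ _ => Iff.rfl, fun _ => rfl⟩

/-- The iposet `_{V ∖ A} V_V` of an up-step `d⁰_A : U → V`. -/
noncomputable def up (d : Coface U V) (h : d.B = ∅) : Between U V where
  P := discrete V d.Aᶜ Set.univ
  src := (Equiv.ofInjective _ d.emb.injective).trans
    (Equiv.setCongr (by rw [d.range_emb, h, Set.union_empty]; rfl))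
  tgt := (Equiv.Set.univ _).symm
  src_iso := ⟨fun _ _ => d.emb.lt_iff_lt, d.lab_emb⟩
  tgt_iso := ⟨fun _ _ => Iff.rfl, fun _ => rfl⟩

/-- The iposet `_V V_{V ∖ B}` of a down-step `d¹_B : U → V`. -/
noncomputable def down (d : Coface U V) (h : d.A = ∅) : Between V U where
  P := discrete V Set.univ d.Bᶜ
  src := (Equiv.Set.univ _).symm
  tgt := (Equiv.ofInjective _ d.emb.injective).trans
    (Equiv.setCongr (by rw [d.range_emb, h, Set.empty_union]; rfl))
  src_iso := ⟨fun _ _ => Iff.rfl, fun _ => rfl⟩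
  tgt_iso := ⟨fun _ _ => d.emb.lt_iff_lt, d.lab_emb⟩

end Between

end Iposet

/-! ### Paths and languages -/

section Paths

variable {Act : Type v} {C : Type v} [Category.{0} C]

/-- Steps between cells of a presheaf `X` on a category `C` over `□`, where `F` gives the
underlying words and coface maps: `C = □` with the identity functor for precubical sets, `C = I□`
with the forgetful functor for precubical sets with interfaces.
* `up`: a step along `φ = d⁰_A : U → V` from `x = δ⁰_A(y)` in `X[U]` to `y` in `X[V]`;
* `down`: a step along `φ = d¹_B : V → U` from `x` in `X[U]` to `y = δ¹_B(x)` in `X[V]`. -/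
inductive Step (F : C ⥤ LoWord Act) (X : Cᵒᵖ ⥤ Type w) : Cell X → Cell X → Type (max v w)
  | up {x y : Cell X} (φ : x.1 ⟶ y.1) (hB : Coface.B (F.map φ) = ∅)
      (h : X.map φ.op y.2 = x.2) : Step F X x y
  | down {x y : Cell X} (φ : y.1 ⟶ x.1) (hA : Coface.A (F.map φ) = ∅)
      (h : X.map φ.op x.2 = y.2) : Step F X x y

/-- Paths from a cell to a cell: finite composable sequences of steps. -/
inductive HPath (F : C ⥤ LoWord Act) (X : Cᵒᵖ ⥤ Type w) : Cell X → Cell X → Type (max v w)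
  | nil (x : Cell X) : HPath F X x x
  | snoc {x y z : Cell X} (p : HPath F X x y) (s : Step F X y z) : HPath F X x z

variable {F : C ⥤ LoWord Act} {X : Cᵒᵖ ⥤ Type w}

/-- The iposet of a step. -/
noncomputable def Step.ev {x y : Cell X} :
    Step F X x y → Iposet.Between (F.obj x.1) (F.obj y.1)
  | .up φ hB _ => Iposet.Between.up (F.map φ) hB
  | .down φ hA _ => Iposet.Between.down (F.map φ) hA

/-- The event iposet of a path: the gluing of the iposets of its steps. -/
noncomputable def HPath.ev :
    {x y : Cell X} → HPath F X x y → Iposet.Between (F.obj x.1) (F.obj y.1)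
  | _, _, .nil x => Iposet.Between.id (F.obj x.1)
  | _, _, .snoc p s => p.ev.glue s.ev

end Paths

/-- The ipomsets of the accepting paths of an HDA. -/
def HDA.Lang {Act : Type v} (H : HDA.{v, w} Act) : Set (Ipomset Act) :=
  {P | ∃ x ∈ H.start, ∃ y ∈ H.accept, ∃ p : HPath (𝟭 (LoWord Act)) H.X x y,
    Ipomset.mk p.ev.P = P}

/-- The ipomsets of the accepting paths of an iHDA. -/
def IHDA.Lang {Act : Type v} (H : IHDA.{v, w} Act) : Set (Ipomset Act) :=
  {P | ∃ x ∈ H.start, ∃ y ∈ H.accept, ∃ p : HPath (IloWord.forget Act) H.X x y,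
    Ipomset.mk p.ev.P = P}

/-!
Give each event of a path the time at which it starts and the time at which it ends; this is an
interval representation of the event ipomset. A state of the event ipomset `Q` of a path, given by
the events that have not started and those that are done, determines a cell: the face, at these
two sets, of the cell of the path at any compatible time, which does not depend on that time. If
`P ⊑ Q` then the states of `P` are states of `Q`. An interval representation of `P` in which no
event starts when another one ends lists states of `P` such that consecutive ones differ by a
starter or a terminator, so their cells form a path, with event ipomset `P`.
-/

/-! ### Faces in the precube categories -/

namespace Coface

variable {Act : Type v} {U V W : LoWord Act}

theorem preimage_emb_A_comp (d : Coface U V) (e : Coface V W) :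
    e.emb ⁻¹' (d.comp e).A = d.A := by
  ext j
  simp [comp, e.emb_notMem_A]

theorem preimage_emb_B_comp (d : Coface U V) (e : Coface V W) :
    e.emb ⁻¹' (d.comp e).B = d.B := by
  ext j
  simp [comp, e.emb_notMem_B]

theorem image_preimage_emb (d : Coface U V) (s : Set (Fin V.n)) :
    d.emb '' (d.emb ⁻¹' s) = s \ (d.A ∪ d.B) := by
  rw [Set.image_preimage_eq_inter_range, d.range_emb, Set.sdiff_eq]

theorem image_preimage_emb_union_A (d : Coface U V) {s : Set (Fin V.n)} (hA : d.A ⊆ s)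
    (hB : Disjoint s d.B) : d.emb '' (d.emb ⁻¹' s) ∪ d.A = s := by
  rw [image_preimage_emb, Set.union_comm d.A d.B, ← Set.sdiff_sdiff, hB.sdiff_eq_left,
    Set.sdiff_union_of_subset hA]

theorem image_preimage_emb_union_B (d : Coface U V) {s : Set (Fin V.n)} (hB : d.B ⊆ s)
    (hA : Disjoint s d.A) : d.emb '' (d.emb ⁻¹' s) ∪ d.B = s := by
  rw [image_preimage_emb, ← Set.sdiff_sdiff, hA.sdiff_eq_left, Set.sdiff_union_of_subset hB]

theorem exists_of_disjoint (V : LoWord Act) (A B : Set (Fin V.n)) (h : Disjoint A B) :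
    ∃ (U : LoWord Act) (d : Coface U V), d.A = A ∧ d.B = B := by
  classical
  let s : Finset (Fin V.n) := (A ∪ B)ᶜ.toFinset
  exact ⟨⟨s.card, fun i => V.lab (s.orderEmbOfFin rfl i)⟩,
    { emb := s.orderEmbOfFin rfl
      lab_emb := fun _ => rfl
      A := A
      B := B
      disj := h
      range_emb := by rw [Finset.range_orderEmbOfFin]; simp [s] }, rfl, rfl⟩

theorem exists_emb_comp_eq (d : Coface V W) (e : Coface U W) (hA : d.A ⊆ e.A)
    (hB : d.B ⊆ e.B) : ∃ k : Fin U.n ↪o Fin V.n, ∀ i, d.emb (k i) = e.emb i := by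
  choose k hk using fun i => d.exists_emb (e.emb i)
    (fun h => e.emb_notMem_A i (hA h)) (fun h => e.emb_notMem_B i (hB h))
  exact ⟨OrderEmbedding.ofMapLEIff k fun i j => by
    rw [← d.emb.le_iff_le, hk, hk, e.emb.le_iff_le], hk⟩

theorem exists_comp_eq (d : Coface V W) (e : Coface U W) (hA : d.A ⊆ e.A) (hB : d.B ⊆ e.B) :
    ∃ f : Coface U V, f.comp d = e := by
  obtain ⟨k, hk⟩ := exists_emb_comp_eq d e hA hB
  have range_k : Set.range k = (d.emb ⁻¹' e.A ∪ d.emb ⁻¹' e.B)ᶜ := by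
    rw [← Set.preimage_union, ← Set.preimage_compl, ← e.range_emb, ← funext hk,
      Set.range_comp' d.emb k, d.emb.injective.preimage_image]
  exact ⟨
    { emb := k
      lab_emb := fun i => by rw [← d.lab_emb, hk, e.lab_emb]
      A := d.emb ⁻¹' e.A
      B := d.emb ⁻¹' e.B
      disj := e.disj.preimage _
      range_emb := range_k },
    Coface.ext (DFunLike.ext _ _ hk)
      (d.image_preimage_emb_union_A hA (e.disj.mono_right hB))
      (d.image_preimage_emb_union_B hB (e.disj.symm.mono_right hA))⟩

end Coface

/-- The structure of a category over `□` that governs which faces its objects have: every object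
has sets `S` and `T` of events that cannot be unstarted resp. terminated, all other faces exist,
and faces factor through larger faces. It allows precubical sets with and without interfaces to be
treated simultaneously. -/
structure FaceSystem {Act : Type v} {C : Type v} [Category.{0} C] (F : C ⥤ LoWord Act) where
  S : ∀ c, Set (Fin (F.obj c).n)
  T : ∀ c, Set (Fin (F.obj c).n)
  preimage_S : ∀ {c d : C} (φ : c ⟶ d), Coface.emb (F.map φ) ⁻¹' S d = S c
  preimage_T : ∀ {c d : C} (φ : c ⟶ d), Coface.emb (F.map φ) ⁻¹' T d = T c
  disj_S : ∀ {c d : C} (φ : c ⟶ d), Disjoint (Coface.A (F.map φ)) (S d)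
  disj_T : ∀ {c d : C} (φ : c ⟶ d), Disjoint (Coface.B (F.map φ)) (T d)
  exists_face : ∀ (d : C) (A B : Set (Fin (F.obj d).n)), Disjoint A B → Disjoint A (S d) →
    Disjoint B (T d) → ∃ (c : C) (φ : c ⟶ d), Coface.A (F.map φ) = A ∧ Coface.B (F.map φ) = B
  factor : ∀ {c d e : C} (φ : d ⟶ e) (ψ : c ⟶ e), Coface.A (F.map φ) ⊆ Coface.A (F.map ψ) →
    Coface.B (F.map φ) ⊆ Coface.B (F.map ψ) → ∃ θ : c ⟶ d, θ ≫ φ = ψ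

/-- The face system of `□`: every event can be unstarted and terminated. -/
def LoWord.faceSystem (Act : Type v) : FaceSystem (𝟭 (LoWord Act)) where
  S _ := ∅
  T _ := ∅
  preimage_S _ := rfl
  preimage_T _ := rfl
  disj_S _ := disjoint_bot_right
  disj_T _ := disjoint_bot_right
  exists_face d A B h _ _ := Coface.exists_of_disjoint d A B h
  factor := Coface.exists_comp_eq

theorem ICoface.exists_comp_eq {Act : Type v} {U V W : IloWord Act} (d : ICoface V W)
    (e : ICoface U W) (hA : d.base.A ⊆ e.base.A) (hB : d.base.B ⊆ e.base.B) :
    ∃ f : U ⟶ V, f ≫ d = e := by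
  obtain ⟨f, hf⟩ := Coface.exists_comp_eq d.base e.base hA hB
  have preimage_comp (s : Set (Fin W.lo.n)) :
      e.base.emb ⁻¹' s = f.emb ⁻¹' (d.base.emb ⁻¹' s) := by rw [← hf]; rfl
  refine ⟨⟨f, ?_, ?_, ?_, ?_⟩, ICoface.ext hf⟩
  · rw [e.preimage_S, d.preimage_S, preimage_comp]
  · rw [e.preimage_T, d.preimage_T, preimage_comp]
  · rw [d.preimage_S, ← f.preimage_emb_A_comp d.base, hf]
    exact e.disj_S.preimage _
  · rw [d.preimage_T, ← f.preimage_emb_B_comp d.base, hf]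
    exact e.disj_T.preimage _

/-- The face system of `I□`: the events in the interfaces cannot be unstarted resp. terminated. -/
def IloWord.faceSystem (Act : Type v) : FaceSystem (IloWord.forget Act) where
  S c := c.S
  T c := c.T
  preimage_S φ := (ICoface.preimage_S φ).symm
  preimage_T φ := (ICoface.preimage_T φ).symm
  disj_S φ := ICoface.disj_S φ
  disj_T φ := ICoface.disj_T φ
  exists_face d A B h hS hT := by
    obtain ⟨U, e, rfl, rfl⟩ := Coface.exists_of_disjoint d.lo A B h
    exact ⟨⟨U, e.emb ⁻¹' d.S, e.emb ⁻¹' d.T⟩, ⟨e, rfl, rfl, hS, hT⟩, rfl, rfl⟩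
  factor := ICoface.exists_comp_eq

/-! ### States and timings of iposets -/

namespace Iposet

variable {Act : Type v} {P Q R : Iposet Act}

/-- A stage in the execution of `P`: the events in `unstarted` have not begun, those in `done` have
ended, and the others are running. -/
structure State (P : Iposet Act) where
  unstarted : Set P.carrier
  done : Set P.carrier
  disjoint : Disjoint unstarted done
  not_prec : ∀ x ∉ done, ∀ y ∉ unstarted, ¬ P.prec x y
  disjoint_S : Disjoint unstarted P.S
  disjoint_T : Disjoint done P.T

namespace State

/-- The state in which exactly the source interface is running. -/
def start (P : Iposet Act) : State P where
  unstarted := P.Sᶜ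
  done := ∅
  disjoint := disjoint_bot_right
  not_prec x _ y hy := P.S_minimal y (not_not.1 hy) x
  disjoint_S := disjoint_compl_left
  disjoint_T := disjoint_bot_left

/-- The state in which exactly the target interface is running. -/
def finish (P : Iposet Act) : State P where
  unstarted := ∅
  done := P.Tᶜ
  disjoint := disjoint_bot_left
  not_prec x hx y _ := P.T_maximal x (not_not.1 hx) y
  disjoint_S := disjoint_bot_left
  disjoint_T := disjoint_compl_left

/-- A subsumption only adds precedences, hence turns states of `P` into states of `Q`. -/
def map {f : P.carrier ≃ Q.carrier} (hf : IsSubsumption P Q f) (σ : State P) : State Q where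
  unstarted := f.symm ⁻¹' σ.unstarted
  done := f.symm ⁻¹' σ.done
  disjoint := σ.disjoint.preimage _
  not_prec x hx y hy h := σ.not_prec _ hx _ hy (hf.reflects_prec _ _ (by simpa using h))
  disjoint_S := by
    rw [← hf.image_S, f.image_eq_preimage_symm]
    exact σ.disjoint_S.preimage _
  disjoint_T := by
    rw [← hf.image_T, f.image_eq_preimage_symm]
    exact σ.disjoint_T.preimage _

theorem map_start {f : P.carrier ≃ Q.carrier} (hf : IsSubsumption P Q f) :
    (start P).map hf = start Q := by
  simp only [map, start, ← hf.image_S, f.image_eq_preimage_symm, Set.preimage_compl,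
    Set.preimage_empty]

theorem map_finish {f : P.carrier ≃ Q.carrier} (hf : IsSubsumption P Q f) :
    (finish P).map hf = finish Q := by
  simp only [map, finish, ← hf.image_T, f.image_eq_preimage_symm, Set.preimage_compl,
    Set.preimage_empty]

/-- With birth times `b` and death times `t`, the state `σ` is compatible with the time `k` if its
started events are born by time `k` and its unfinished events are not dead before time `k`. -/
def CompatibleAt (σ : State P) (b t : P.carrier → ℕ) (k : ℕ) : Prop :=
  (∀ e ∉ σ.unstarted, b e ≤ k) ∧ ∀ e ∉ σ.done, k ≤ t e

end State

/-- An interval representation of `P` by birth times `b` and death times `t` in `{0, …, n}` for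
which the interfaces consist of the events that are born at time `0` resp. die at time `n`. -/
structure Timing (P : Iposet Act) (n : ℕ) (b t : P.carrier → ℕ) : Prop where
  birth_le : ∀ e, b e ≤ n
  death_le : ∀ e, t e ≤ n
  mem_S_iff : ∀ e, e ∈ P.S ↔ b e = 0
  mem_T_iff : ∀ e, e ∈ P.T ↔ t e = n
  prec_iff : ∀ x y, P.prec x y ↔ t x < b y

namespace Timing

variable {n k : ℕ} {b t : P.carrier → ℕ}

theorem birth_le_death (h : P.Timing n b t) (e : P.carrier) : b e ≤ t e :=
  not_lt.1 fun hlt => P.prec_irrefl e ((h.prec_iff e e).2 hlt)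

theorem not_prec_of_birth_eq (h : P.Timing n b t) {x y : P.carrier}
    (hxy : b x = b y) : ¬ P.prec x y := by
  rw [h.prec_iff, ← hxy]
  exact (h.birth_le_death x).not_gt

theorem isInterval (h : P.Timing n b t) : P.IsInterval :=
  ⟨fun e => b e, fun e => t e, fun e => Nat.cast_le.2 (h.birth_le_death e),
    fun x y => (h.prec_iff x y).trans Nat.cast_lt.symm⟩

/-- The state at time `k`. -/
def state (h : P.Timing n b t) (hk : k ≤ n) : State P where
  unstarted := {e | k < b e}
  done := {e | t e < k}
  disjoint := Set.disjoint_left.2 fun e (hU : k < b e) (hD : t e < k) =>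
    (hD.trans hU).not_ge (h.birth_le_death e)
  not_prec x hx y hy hxy :=
    (((not_lt.1 hy).trans (not_lt.1 hx)).not_gt ((h.prec_iff x y).1 hxy))
  disjoint_S := Set.disjoint_left.2 fun e (hU : k < b e) hS => by
    have := (h.mem_S_iff e).1 hS
    omega
  disjoint_T := Set.disjoint_left.2 fun e (hD : t e < k) hT => by
    have := (h.mem_T_iff e).1 hT
    omega

theorem state_zero (h : P.Timing n b t) : h.state n.zero_le = State.start P := by
  simp only [state, State.start, State.mk.injEq]
  constructor <;> ext e <;> simp [h.mem_S_iff, Nat.pos_iff_ne_zero]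

theorem state_last (h : P.Timing n b t) : h.state le_rfl = State.finish P := by
  simp only [state, State.finish, State.mk.injEq]
  constructor <;> ext e <;> simp [h.birth_le, h.mem_T_iff, (h.death_le e).lt_iff_ne]

theorem exists_compatibleAt (h : P.Timing n b t) (σ : State P) :
    ∃ k ≤ n, σ.CompatibleAt b t k := by
  let bounds : Set ℕ := {k | ∀ e ∉ σ.unstarted, b e ≤ k}
  have n_mem : n ∈ bounds := fun e _ => h.birth_le e
  refine ⟨sInf bounds, Nat.sInf_le n_mem, Nat.sInf_mem ⟨n, n_mem⟩, fun x hx => ?_⟩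
  have death_mem : t x ∈ bounds := fun y hy =>
    not_lt.1 fun hlt => σ.not_prec x hx y hy ((h.prec_iff x y).2 hlt)
  exact Nat.sInf_le death_mem

end Timing

/-- The iposets of up-steps and down-steps are starters resp. terminators: discrete iposets in
which all events are in the target interface resp. in the source interface. -/
structure IsStarterOrTerminator (R : Iposet Act) : Prop where
  not_prec : ∀ x y, ¬ R.prec x y
  S_or_T : R.S = Set.univ ∨ R.T = Set.univ

theorem IsStarterOrTerminator.mem_S_of_notMem_T (hR : R.IsStarterOrTerminator) {x : R.carrier}
    (hx : x ∉ R.T) (y : R.carrier) : y ∈ R.S := by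
  rcases hR.S_or_T with h | h
  · exact h ▸ Set.mem_univ y
  · exact (hx (h ▸ Set.mem_univ x)).elim

theorem IsStarterOrTerminator.mem_S_or_mem_T (hR : R.IsStarterOrTerminator) (y : R.carrier) :
    y ∈ R.S ∨ y ∈ R.T := by
  rcases hR.S_or_T with h | h <;> simp only [h, Set.mem_univ, true_or, or_true]

namespace InterfaceIso

variable (f : InterfaceIso P R)

theorem eq_inl_or_eq_inr (a : f.Carrier) :
    (∃ x ∉ P.T, a = f.inl x) ∨ ∃ y, a = f.inr y := by
  rcases f.cases a with ⟨x, rfl⟩ | ⟨y, -, rfl⟩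
  · by_cases hx : x ∈ P.T
    · exact Or.inr ⟨_, f.inl_eq_inr.2 ⟨hx, rfl⟩⟩
    · exact Or.inl ⟨x, hx, rfl⟩
  · exact Or.inr ⟨y, rfl⟩

theorem exists_inl_eq_inr {y : R.carrier} (hy : y ∈ R.S) :
    ∃ x ∈ P.T, f.inl x = f.inr y :=
  ⟨_, (f.toEquiv.symm ⟨y, hy⟩).2, f.inl_eq_inr.2 ⟨(f.toEquiv.symm ⟨y, hy⟩).2, by simp⟩⟩

theorem inl_ne_inr {x : P.carrier} (hx : x ∉ P.T) (y : R.carrier) : f.inl x ≠ f.inr y :=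
  fun h => hx (f.inl_eq_inr.1 h).1

/-- Birth times on a gluing, where the second iposet happens at time `n + 1`. -/
def glueBirth (n : ℕ) (b : P.carrier → ℕ) : f.Carrier → ℕ :=
  Sum.elim b fun _ => n + 1

open Classical in
/-- Death times on a gluing, where the first iposet ends at time `n`, and the second is a starter
or a terminator and ends at time `n + 1`. -/
noncomputable def glueDeath (n : ℕ) (t : P.carrier → ℕ) (a : f.Carrier) : ℕ :=
  if a ∈ f.inr '' R.T then n + 1 else Sum.elim t (fun _ => n) a

variable {f} {n k : ℕ} {b t : P.carrier → ℕ}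

theorem glueBirth_inr {y : R.carrier} (hy : y ∉ R.S) : f.glueBirth n b (f.inr y) = n + 1 := by
  simp [glueBirth, inr, hy]

theorem glueDeath_inl {x : P.carrier} (hx : x ∉ P.T) : f.glueDeath n t (f.inl x) = t x :=
  if_neg fun ⟨_, _, h⟩ => f.inl_ne_inr hx _ h.symm

theorem glueDeath_inr_of_mem {y : R.carrier} (hy : y ∈ R.T) :
    f.glueDeath n t (f.inr y) = n + 1 :=
  if_pos (Set.mem_image_of_mem _ hy)

theorem glueDeath_inr_of_notMem (ht : ∀ x ∈ P.T, t x = n) {y : R.carrier} (hy : y ∉ R.T) :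
    f.glueDeath n t (f.inr y) = n := by
  rw [glueDeath, if_neg (by rwa [f.inr_injective.mem_set_image])]
  by_cases hS : y ∈ R.S
  · obtain ⟨x, hx, hxy⟩ := f.exists_inl_eq_inr hS
    rw [← hxy]
    exact ht x hx
  · simp [inr, hS]

theorem le_glueDeath_inl_iff (ht : ∀ x ∈ P.T, t x = n) (hk : k ≤ n) (x : P.carrier) :
    k ≤ f.glueDeath n t (f.inl x) ↔ k ≤ t x := by
  by_cases hx : x ∈ P.T
  · rw [f.inl_eq_inr.2 ⟨hx, rfl⟩, ht x hx]
    by_cases hT : (f.toEquiv ⟨x, hx⟩ : R.carrier) ∈ R.T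
    · rw [glueDeath_inr_of_mem hT]
      omega
    · rw [glueDeath_inr_of_notMem ht hT]
  · rw [glueDeath_inl hx]

end InterfaceIso

namespace Timing

variable {n : ℕ} {b t : P.carrier → ℕ} {f : InterfaceIso P R}

theorem glueDeath_lt_iff (h : P.Timing n b t) (a : f.Carrier) :
    f.glueDeath n t a < n + 1 ↔ a ∉ f.inr '' R.T := by
  rcases f.eq_inl_or_eq_inr a with ⟨x, hx, rfl⟩ | ⟨y, rfl⟩
  · have not_image : f.inl x ∉ f.inr '' R.T := fun ⟨y, _, hy⟩ => f.inl_ne_inr hx y hy.symm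
    simpa [InterfaceIso.glueDeath_inl hx, not_image] using Nat.lt_succ_of_le (h.death_le x)
  · rw [f.inr_injective.mem_set_image]
    by_cases hy : y ∈ R.T
    · simp [InterfaceIso.glueDeath_inr_of_mem, hy]
    · simp [InterfaceIso.glueDeath_inr_of_notMem (fun x => (h.mem_T_iff x).1) hy, hy]

theorem glue_prec_iff (h : P.Timing n b t) (hR : R.IsStarterOrTerminator) (a c : f.Carrier) :
    f.Prec a c ↔ f.glueDeath n t a < f.glueBirth n b c := by
  have ht : ∀ x ∈ P.T, t x = n := fun x => (h.mem_T_iff x).1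
  constructor
  · rintro (hxy | hxy | ⟨hx, hy⟩)
    · rw [InterfaceIso.glueDeath_inl fun hT => P.T_maximal _ hT _ hxy]
      exact (h.prec_iff _ _).1 hxy
    · exact (hR.not_prec _ _ hxy).elim
    · rw [InterfaceIso.glueDeath_inl hx, InterfaceIso.glueBirth_inr hy]
      exact Nat.lt_succ_of_le (h.death_le _)
  · intro hac
    rcases f.cases c with ⟨y, rfl⟩ | ⟨y, hy, rfl⟩ <;>
      rcases f.eq_inl_or_eq_inr a with ⟨x, hx, rfl⟩ | ⟨x, rfl⟩
    · rw [InterfaceIso.glueDeath_inl hx] at hac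
      exact .left ((h.prec_iff x y).2 hac)
    · have hdeath : n ≤ f.glueDeath n t (f.inr x) := by
        by_cases hx : x ∈ R.T
        · exact (InterfaceIso.glueDeath_inr_of_mem hx).ge.trans' n.le_succ
        · exact (InterfaceIso.glueDeath_inr_of_notMem ht hx).ge
      exact (((h.birth_le y).trans hdeath).not_gt hac).elim
    · exact .cross hx hy
    · rw [InterfaceIso.glueBirth_inr hy, h.glueDeath_lt_iff, f.inr_injective.mem_set_image] at hac
      exact (hy (hR.mem_S_of_notMem_T hac y)).elim

theorem glue (h : P.Timing n b t) (hR : R.IsStarterOrTerminator) :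
    (P.glue R f).Timing (n + 1) (f.glueBirth n b) (f.glueDeath n t) where
  birth_le a := by
    rcases a with x | y
    · exact (h.birth_le x).trans n.le_succ
    · exact le_rfl
  death_le a := by
    by_cases ha : a ∈ f.inr '' R.T
    · exact (if_pos ha).le
    · exact ((h.glueDeath_lt_iff a).2 ha).le
  mem_S_iff a := by
    rcases f.cases a with ⟨x, rfl⟩ | ⟨y, hy, rfl⟩
    · exact f.inl_injective.mem_set_image.trans (h.mem_S_iff x)
    · rw [InterfaceIso.glueBirth_inr hy]
      refine iff_of_false ?_ n.succ_ne_zero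
      rintro ⟨x, -, hx⟩
      obtain ⟨hT, rfl⟩ := f.inl_eq_inr.1 hx
      exact hy (f.toEquiv ⟨x, hT⟩).2
  mem_T_iff a := by
    refine ⟨fun ha => if_pos ha, fun heq => ?_⟩
    by_contra ha
    exact heq.not_lt ((h.glueDeath_lt_iff a).2 ha)
  prec_iff := h.glue_prec_iff hR

end Timing

end Iposet

/-! ### Marked cells and their faces -/

section MarkedCells

variable {Act : Type v} {C : Type v} [Category.{0} C] {F : C ⥤ LoWord Act}
  {X : Cᵒᵖ ⥤ Type w} {P Q R : Iposet Act}

/-- A cell of `X` together with an identification of its events with events of `P`. -/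
structure MarkedCell (F : C ⥤ LoWord Act) (X : Cᵒᵖ ⥤ Type w) (P : Iposet Act) where
  cell : Cell X
  mark : Fin (F.obj cell.1).n → P.carrier
  evt_mark : ∀ i j, i < j → P.evt (mark i) (mark j)
  lab_mark : ∀ i, P.lab (mark i) = (F.obj cell.1).lab i

namespace MarkedCell

theorem mark_injective (c : MarkedCell F X P) : Function.Injective c.mark := by
  intro i j hij
  by_contra hne
  rcases lt_or_gt_of_ne hne with h | h
  · exact P.evt_irrefl _ (hij ▸ c.evt_mark i j h)
  · exact P.evt_irrefl _ (hij ▸ c.evt_mark j i h)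

/-- The marked cell obtained by renaming the events along `g`. -/
def map (c : MarkedCell F X P) (g : P.carrier → Q.carrier)
    (hevt : ∀ i j, P.evt (c.mark i) (c.mark j) → Q.evt (g (c.mark i)) (g (c.mark j)))
    (hlab : ∀ i, Q.lab (g (c.mark i)) = P.lab (c.mark i)) : MarkedCell F X Q where
  cell := c.cell
  mark := g ∘ c.mark
  evt_mark i j hij := hevt i j (c.evt_mark i j hij)
  lab_mark i := (hlab i).trans (c.lab_mark i)

/-- The marked cell in a gluing obtained from one in the left factor. -/
noncomputable def mapInl (f : Iposet.InterfaceIso P R) (c : MarkedCell F X P) :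
    MarkedCell F X (P.glue R f) :=
  c.map f.inl (fun _ _ => f.evt_inl_iff.2) fun _ => rfl

/-- The marked cell in a gluing obtained from one in the right factor. -/
noncomputable def mapInr (f : Iposet.InterfaceIso P R) (c : MarkedCell F X R) :
    MarkedCell F X (P.glue R f) :=
  c.map f.inr (fun _ _ => f.evt_inr_iff.2) fun _ => f.lab_inr _

/-- The marking of a cell by the source interface of an iposet. -/
def ofSrc (x : Cell X) {V : LoWord Act} (R : Iposet.Between (F.obj x.1) V) :
    MarkedCell F X R.P where
  cell := x
  mark i := R.src i
  evt_mark i j := (R.src_iso.evt_iff i j).2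
  lab_mark := R.src_iso.lab_eq

/-- The marking of a cell by the target interface of an iposet. -/
def ofTgt (y : Cell X) {U : LoWord Act} (R : Iposet.Between U (F.obj y.1)) :
    MarkedCell F X R.P where
  cell := y
  mark i := R.tgt i
  evt_mark i j := (R.tgt_iso.evt_iff i j).2
  lab_mark := R.tgt_iso.lab_eq

theorem range_mark_ofSrc (x : Cell X) {V : LoWord Act} (R : Iposet.Between (F.obj x.1) V) :
    Set.range (ofSrc x R).mark = R.P.S :=
  (EquivLike.range_comp Subtype.val R.src).trans Subtype.range_coe

theorem range_mark_ofTgt (y : Cell X) {U : LoWord Act} (R : Iposet.Between U (F.obj y.1)) :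
    Set.range (ofTgt y R).mark = R.P.T :=
  (EquivLike.range_comp Subtype.val R.tgt).trans Subtype.range_coe

theorem mapInl_ofTgt (y : Cell X) {U V : LoWord Act} (P : Iposet.Between U (F.obj y.1))
    (R : Iposet.Between (F.obj y.1) V) :
    (ofTgt y P).mapInl (P.interfaceIso R) = (ofSrc y R).mapInr (P.interfaceIso R) := by
  have inl_tgt (i) : (P.interfaceIso R).inl (P.tgt i) = (P.interfaceIso R).inr (R.src i) :=
    (P.interfaceIso R).inl_eq_inr.2 ⟨(P.tgt i).2, by simp [Iposet.Between.interfaceIso]⟩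
  simp only [mapInl, mapInr, map, mk.injEq]
  exact ⟨rfl, heq_of_eq (funext inl_tgt)⟩

/-- `z` is the face of `c` in which the events of `c` in `U` are unstarted and those in `D` are
terminated. Membership of other events in `U` and `D` is irrelevant. -/
def IsFace (U D : Set P.carrier) (z c : MarkedCell F X P) : Prop :=
  ∃ φ : z.cell.1 ⟶ c.cell.1, X.map φ.op c.cell.2 = z.cell.2 ∧
    c.mark ∘ Coface.emb (F.map φ) = z.mark ∧
    Coface.A (F.map φ) = c.mark ⁻¹' U ∧ Coface.B (F.map φ) = c.mark ⁻¹' D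

variable {U D U₀ D₀ : Set P.carrier} {z c d : MarkedCell F X P}

theorem IsFace.congr (h : IsFace U D z c) (hU : c.mark ⁻¹' U = c.mark ⁻¹' U₀)
    (hD : c.mark ⁻¹' D = c.mark ⁻¹' D₀) : IsFace U₀ D₀ z c := by
  obtain ⟨φ, hX, hmark, hA, hB⟩ := h
  exact ⟨φ, hX, hmark, hA.trans hU, hB.trans hD⟩

theorem isFace_self (c : MarkedCell F X P) : IsFace ∅ ∅ c c :=
  ⟨𝟙 _, by simp, by rw [F.map_id]; rfl, by rw [F.map_id]; rfl, by rw [F.map_id]; rfl⟩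

theorem IsFace.range_mark (h : IsFace U D z c) :
    Set.range z.mark = Set.range c.mark \ (U ∪ D) := by
  obtain ⟨φ, -, hmark, hA, hB⟩ := h
  rw [← hmark, Set.range_comp, Coface.range_emb, hA, hB, ← Set.preimage_union,
    ← Set.preimage_compl, Set.image_preimage_eq_inter_range, Set.inter_comm, Set.sdiff_eq]

theorem IsFace.map {g : P.carrier → Q.carrier} (h : IsFace U D z c)
    (hg : Function.Injective g) {zevt zlab cevt clab} :
    IsFace (g '' U) (g '' D) (z.map g zevt zlab) (c.map g cevt clab) := by
  obtain ⟨φ, hX, hmark, hA, hB⟩ := h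
  have preimage_eq (s : Set P.carrier) : c.mark ⁻¹' s = (g ∘ c.mark) ⁻¹' (g '' s) := by
    rw [Set.preimage_comp, hg.preimage_image]
  exact ⟨φ, hX, congrArg (g ∘ ·) hmark, hA.trans (preimage_eq U), hB.trans (preimage_eq D)⟩

theorem IsFace.trans (hz : IsFace U D z c) (hc : IsFace U₀ D₀ c d) (hUD : Disjoint U D)
    (hU : d.mark ⁻¹' U₀ ⊆ d.mark ⁻¹' U) (hD : d.mark ⁻¹' D₀ ⊆ d.mark ⁻¹' D) :
    IsFace U D z d := by
  obtain ⟨ψ, hXψ, hmψ, hAψ, hBψ⟩ := hz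
  obtain ⟨φ, hXφ, hmφ, hAφ, hBφ⟩ := hc
  have hdisj : Disjoint (d.mark ⁻¹' U) (d.mark ⁻¹' D) := hUD.preimage _
  rw [← hmφ, Set.preimage_comp] at hAψ hBψ
  refine ⟨ψ ≫ φ, by simp [hXφ, hXψ], ?_, ?_, ?_⟩
  · rw [F.map_comp, ← hmψ, ← hmφ]
    rfl
  · rw [F.map_comp]
    refine (congrArg (Coface.emb (F.map φ) '' · ∪ _) hAψ).trans ?_
    exact Coface.image_preimage_emb_union_A _ (hAφ ▸ hU) (hBφ ▸ hdisj.mono_right hD)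
  · rw [F.map_comp]
    refine (congrArg (Coface.emb (F.map φ) '' · ∪ _) hBψ).trans ?_
    exact Coface.image_preimage_emb_union_B _ (hBφ ▸ hD) (hAφ ▸ hdisj.symm.mono_right hU)

theorem IsFace.cancel (Φ : FaceSystem F) (hz : IsFace U D z d) (hc : IsFace U₀ D₀ c d)
    (hU : d.mark ⁻¹' U₀ ⊆ d.mark ⁻¹' U) (hD : d.mark ⁻¹' D₀ ⊆ d.mark ⁻¹' D) :
    IsFace U D z c := by
  obtain ⟨ψ, hXψ, hmψ, hAψ, hBψ⟩ := hz
  obtain ⟨φ, hXφ, hmφ, hAφ, hBφ⟩ := hc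
  obtain ⟨θ, rfl⟩ := Φ.factor φ ψ (hAφ.trans_subset (hU.trans_eq hAψ.symm))
    (hBφ.trans_subset (hD.trans_eq hBψ.symm))
  rw [F.map_comp] at hmψ hAψ hBψ
  refine ⟨θ, by simpa [hXφ] using hXψ, ?_, ?_, ?_⟩
  · rw [← hmφ, ← hmψ]
    rfl
  · rw [← hmφ, Set.preimage_comp, ← hAψ]
    exact (Coface.preimage_emb_A_comp _ _).symm
  · rw [← hmφ, Set.preimage_comp, ← hBψ]
    exact (Coface.preimage_emb_B_comp _ _).symm

theorem IsFace.isFace_iff (Φ : FaceSystem F) (hc : IsFace U₀ D₀ c d) (hUD : Disjoint U D)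
    (hU : d.mark ⁻¹' U₀ ⊆ d.mark ⁻¹' U) (hD : d.mark ⁻¹' D₀ ⊆ d.mark ⁻¹' D) :
    IsFace U D z c ↔ IsFace U D z d :=
  ⟨fun hz => hz.trans hc hUD hU hD, fun hz => hz.cancel Φ hc hU hD⟩

theorem exists_isFace (Φ : FaceSystem F) (c : MarkedCell F X P) (hUD : Disjoint U D)
    (hS : Disjoint U (c.mark '' Φ.S c.cell.1)) (hT : Disjoint D (c.mark '' Φ.T c.cell.1)) :
    ∃ z, IsFace U D z c := by
  obtain ⟨V, φ, hA, hB⟩ := Φ.exists_face c.cell.1 (c.mark ⁻¹' U) (c.mark ⁻¹' D)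
    (hUD.preimage _) ((hS.preimage _).mono_right (Set.subset_preimage_image _ _))
    ((hT.preimage _).mono_right (Set.subset_preimage_image _ _))
  let z : MarkedCell F X P :=
    { cell := ⟨V, X.map φ.op c.cell.2⟩
      mark := c.mark ∘ Coface.emb (F.map φ)
      evt_mark := fun i j hij => c.evt_mark _ _ ((Coface.emb (F.map φ)).lt_iff_lt.2 hij)
      lab_mark := fun i => (c.lab_mark _).trans (Coface.lab_emb (F.map φ) i) }
  exact ⟨z, φ, rfl, rfl, hA, hB⟩

theorem IsFace.image_S (Φ : FaceSystem F) (h : IsFace U D z c) :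
    z.mark '' Φ.S z.cell.1 = c.mark '' Φ.S c.cell.1 \ D := by
  obtain ⟨φ, -, hmark, -, hB⟩ := h
  rw [← hmark, Set.image_comp, ← Φ.preimage_S φ, Coface.image_preimage_emb, ← Set.sdiff_sdiff,
    (Φ.disj_S φ).symm.sdiff_eq_left, hB, Set.image_sdiff_preimage]

theorem IsFace.image_T (Φ : FaceSystem F) (h : IsFace U D z c) :
    z.mark '' Φ.T z.cell.1 = c.mark '' Φ.T c.cell.1 \ U := by
  obtain ⟨φ, -, hmark, hA, -⟩ := h
  rw [← hmark, Set.image_comp, ← Φ.preimage_T φ, Coface.image_preimage_emb, Set.union_comm,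
    ← Set.sdiff_sdiff, (Φ.disj_T φ).symm.sdiff_eq_left, hA, Set.image_sdiff_preimage]

end MarkedCell

/-- Steps between marked cells, in which the surviving events keep their marks. -/
def MarkedStep (c d : MarkedCell F X P) : Prop :=
  (∃ U, MarkedCell.IsFace U ∅ c d) ∨ ∃ D, MarkedCell.IsFace ∅ D d c

namespace MarkedStep

variable {c d : MarkedCell F X P}

theorem map {g : P.carrier → Q.carrier} (h : MarkedStep c d) (hg : Function.Injective g)
    {cevt clab devt dlab} : MarkedStep (c.map g cevt clab) (d.map g devt dlab) := by
  refine h.imp (fun ⟨U, hU⟩ => ⟨g '' U, ?_⟩) (fun ⟨D, hD⟩ => ⟨g '' D, ?_⟩)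
  · simpa only [Set.image_empty] using hU.map hg
  · simpa only [Set.image_empty] using hD.map hg

theorem image_S_subset (Φ : FaceSystem F) (h : MarkedStep c d) :
    d.mark '' Φ.S d.cell.1 ⊆ c.mark '' Φ.S c.cell.1 := by
  rcases h with ⟨U, h⟩ | ⟨D, h⟩
  · rw [h.image_S Φ, Set.sdiff_empty]
  · rw [h.image_S Φ]
    exact Set.sdiff_subset

theorem image_T_subset (Φ : FaceSystem F) (h : MarkedStep c d) :
    c.mark '' Φ.T c.cell.1 ⊆ d.mark '' Φ.T d.cell.1 := by
  rcases h with ⟨U, h⟩ | ⟨D, h⟩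
  · rw [h.image_T Φ]
    exact Set.sdiff_subset
  · rw [h.image_T Φ, Set.sdiff_empty]

theorem exists_step (h : MarkedStep c d) :
    ∃ (s : Step F X c.cell d.cell) (g : s.ev.P.carrier → P.carrier),
      (∀ x y, s.ev.P.evt x y → P.evt (g x) (g y)) ∧ (∀ x, P.lab (g x) = s.ev.P.lab x) ∧
      (∀ i, g (s.ev.src i) = c.mark i) ∧ ∀ i, g (s.ev.tgt i) = d.mark i := by
  rcases h with ⟨U, φ, hX, hmark, -, hB⟩ | ⟨D, φ, hX, hmark, hA, -⟩
  · exact ⟨.up φ hB hX, d.mark, d.evt_mark, d.lab_mark, congrFun hmark, fun _ => rfl⟩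
  · exact ⟨.down φ hA hX, c.mark, c.evt_mark, c.lab_mark, fun _ => rfl, congrFun hmark⟩

end MarkedStep

theorem Step.markedStep {x y : Cell X} (s : Step F X x y) :
    MarkedStep (MarkedCell.ofSrc x s.ev) (MarkedCell.ofTgt y s.ev) := by
  rcases s with ⟨φ, hB, hX⟩ | ⟨φ, hA, hX⟩
  · exact Or.inl ⟨Coface.A (F.map φ), φ, hX, rfl, rfl, hB⟩
  · exact Or.inr ⟨Coface.B (F.map φ), φ, hX, rfl, hA, rfl⟩

theorem Step.isStarterOrTerminator {x y : Cell X} (s : Step F X x y) :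
    s.ev.P.IsStarterOrTerminator := by
  rcases s with ⟨φ, hB, hX⟩ | ⟨φ, hA, hX⟩
  · exact ⟨fun _ _ => not_false, Or.inr rfl⟩
  · exact ⟨fun _ _ => not_false, Or.inl rfl⟩

end MarkedCells

/-! ### Runs -/

section Runs

variable {Act : Type v} {C : Type v} [Category.{0} C] {F : C ⥤ LoWord Act}
  {X : Cᵒᵖ ⥤ Type w} {P : Iposet Act}

/-- The marked cells `c 0, …, c n` form a path in which every event is running exactly from its
birth time to its death time. -/
structure IsRun (n : ℕ) (b t : P.carrier → ℕ) (c : ℕ → MarkedCell F X P) : Prop where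
  step : ∀ k < n, MarkedStep (c k) (c (k + 1))
  range_mark : ∀ k ≤ n, Set.range (c k).mark = {e | b e ≤ k ∧ k ≤ t e}

namespace IsRun

open MarkedCell

theorem range_mapInl {R : Iposet Act} {f : Iposet.InterfaceIso P R} {n k : ℕ}
    {b t : P.carrier → ℕ} (h : P.Timing n b t) (hk : k ≤ n) {c : MarkedCell F X P}
    (hc : Set.range c.mark = {e | b e ≤ k ∧ k ≤ t e}) :
    Set.range (c.mapInl f).mark = {a | f.glueBirth n b a ≤ k ∧ k ≤ f.glueDeath n t a} := by
  refine (Set.range_comp f.inl c.mark).trans ?_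
  rw [hc]
  ext a
  rcases f.cases a with ⟨x, rfl⟩ | ⟨y, hy, rfl⟩
  · rw [f.inl_injective.mem_set_image]
    exact and_congr_right' (Iposet.InterfaceIso.le_glueDeath_inl_iff
      (fun x => (h.mem_T_iff x).1) hk x).symm
  · refine iff_of_false ?_ fun ⟨hle, _⟩ => ?_
    · rintro ⟨x, -, hx⟩
      obtain ⟨hT, rfl⟩ := f.inl_eq_inr.1 hx
      exact hy (f.toEquiv ⟨x, hT⟩).2
    · rw [Iposet.InterfaceIso.glueBirth_inr hy] at hle
      omega

theorem glue {R : Iposet Act} {f : Iposet.InterfaceIso P R} {n : ℕ} {b t : P.carrier → ℕ}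
    {c : ℕ → MarkedCell F X P} (hc : IsRun n b t c) (h : P.Timing n b t)
    (hR : R.IsStarterOrTerminator) {d e : MarkedCell F X R} (hstep : MarkedStep d e)
    (hd : (c n).mapInl f = d.mapInr f) (he : Set.range e.mark = R.T) :
    IsRun (n + 1) (f.glueBirth n b) (f.glueDeath n t)
      fun k => if k ≤ n then (c k).mapInl f else e.mapInr f where
  step k hk := by
    rcases (Nat.lt_succ_iff.1 hk).lt_or_eq with hlt | rfl
    · rw [if_pos hlt.le, if_pos (Nat.succ_le_of_lt hlt)]
      exact (hc.step k hlt).map f.inl_injective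
    · rw [if_pos le_rfl, if_neg k.lt_succ_self.not_ge, hd]
      exact hstep.map f.inr_injective
  range_mark k hk := by
    rcases hk.lt_or_eq with hlt | rfl
    · have hkn : k ≤ n := Nat.lt_succ_iff.1 hlt
      rw [if_pos hkn]
      exact range_mapInl h hkn (hc.range_mark k hkn)
    · have range_mapInr : Set.range (e.mapInr f).mark = (P.glue R f).T :=
        (Set.range_comp f.inr e.mark).trans (congrArg _ he)
      have hglue := h.glue (f := f) hR
      rw [if_neg n.lt_succ_self.not_ge, range_mapInr]
      ext a
      refine (hglue.mem_T_iff a).trans ⟨fun ha => ⟨hglue.birth_le a, ha.ge⟩, fun ha => ?_⟩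
      exact (hglue.death_le a).antisymm ha.2

end IsRun

theorem Iposet.Between.timing_id (U : LoWord Act) :
    (Between.id U).P.Timing 0 (fun _ => 0) fun _ => 0 where
  birth_le _ := le_rfl
  death_le _ := le_rfl
  mem_S_iff _ := iff_of_true trivial rfl
  mem_T_iff _ := iff_of_true trivial rfl
  prec_iff _ _ := iff_of_false not_false (lt_irrefl 0)

theorem HPath.exists_isRun {x y : Cell X} (p : HPath F X x y) :
    ∃ n b t, p.ev.P.Timing n b t ∧ ∃ c, IsRun n b t c ∧ (c 0).cell = x ∧
      c n = MarkedCell.ofTgt y p.ev := by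
  induction p with
  | nil =>
    rw [HPath.ev]
    refine ⟨0, _, _, Iposet.Between.timing_id _, fun _ => MarkedCell.ofTgt x _, ⟨?_, ?_⟩, rfl, rfl⟩
    · exact fun k hk => (k.not_lt_zero hk).elim
    · refine fun k hk => (MarkedCell.range_mark_ofTgt _ _).trans (Set.ext fun e => ?_)
      exact iff_of_true trivial ⟨k.zero_le, hk⟩
  | snoc p s ih =>
    obtain ⟨n, b, t, h, c, hc, hzero, hn⟩ := ih
    have hR := s.isStarterOrTerminator
    have hd := (congrArg _ hn).trans (MarkedCell.mapInl_ofTgt _ p.ev s.ev)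
    rw [HPath.ev]
    exact ⟨n + 1, _, _, h.glue hR, _, hc.glue h hR s.markedStep hd
      (MarkedCell.range_mark_ofTgt _ _), hzero, if_neg n.lt_succ_self.not_ge⟩

theorem HPath.isInterval {x y : Cell X} (p : HPath F X x y) : p.ev.P.IsInterval := by
  obtain ⟨n, b, t, h, -⟩ := p.exists_isRun
  exact h.isInterval

namespace IsRun

open MarkedCell

variable {n : ℕ} {b t : P.carrier → ℕ} {c : ℕ → MarkedCell F X P}

theorem image_S_subset (Φ : FaceSystem F) (hc : IsRun n b t c) {k : ℕ} (hk : k ≤ n) :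
    (c k).mark '' Φ.S (c k).cell.1 ⊆ {e | b e = 0} := by
  have image_subset_zero : (c k).mark '' Φ.S (c k).cell.1 ⊆ (c 0).mark '' Φ.S (c 0).cell.1 := by
    induction k with
    | zero => rfl
    | succ k ih => exact ((hc.step k hk).image_S_subset Φ).trans (ih (Nat.le_of_succ_le hk))
  refine (image_subset_zero.trans (Set.image_subset_range _ _)).trans ?_
  rw [hc.range_mark 0 n.zero_le]
  exact fun e he => Nat.le_zero.1 he.1

theorem image_T_subset (Φ : FaceSystem F) (hc : IsRun n b t c) {k : ℕ} (hk : k ≤ n) :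
    (c k).mark '' Φ.T (c k).cell.1 ⊆ {e | n ≤ t e} := by
  have image_subset_last : (c k).mark '' Φ.T (c k).cell.1 ⊆ (c n).mark '' Φ.T (c n).cell.1 := by
    induction hk using Nat.decreasingInduction with
    | self => rfl
    | of_succ k hk ih => exact ((hc.step k hk).image_T_subset Φ).trans ih
  refine (image_subset_last.trans (Set.image_subset_range _ _)).trans ?_
  rw [hc.range_mark n le_rfl]
  exact fun e he => he.2

theorem exists_isFace (Φ : FaceSystem F) (hc : IsRun n b t c) (h : P.Timing n b t)
    (σ : P.State) {k : ℕ} (hk : k ≤ n) : ∃ z, IsFace σ.unstarted σ.done z (c k) := by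
  refine MarkedCell.exists_isFace Φ (c k) σ.disjoint
    (σ.disjoint_S.mono_right fun e he => ?_) (σ.disjoint_T.mono_right fun e he => ?_)
  · exact (h.mem_S_iff e).2 (hc.image_S_subset Φ hk he)
  · exact (h.mem_T_iff e).2 ((h.death_le e).antisymm (hc.image_T_subset Φ hk he))

variable {σ : P.State} {z : MarkedCell F X P}

theorem range_mark_of_isFace (hc : IsRun n b t c) {k : ℕ} (hk : k ≤ n)
    (hσ : σ.CompatibleAt b t k) (hz : IsFace σ.unstarted σ.done z (c k)) :
    Set.range z.mark = (σ.unstarted ∪ σ.done)ᶜ := by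
  rw [hz.range_mark, hc.range_mark k hk, Set.sdiff_eq, Set.inter_eq_right]
  exact fun e he => ⟨hσ.1 e fun hU => he (Or.inl hU), hσ.2 e fun hD => he (Or.inr hD)⟩

theorem isFace_succ_iff (Φ : FaceSystem F) (hc : IsRun n b t c) {k : ℕ} (hk : k < n)
    (hσ : σ.CompatibleAt b t k) (hσ' : σ.CompatibleAt b t (k + 1)) :
    IsFace σ.unstarted σ.done z (c k) ↔ IsFace σ.unstarted σ.done z (c (k + 1)) := by
  have hrange := hc.range_mark k hk.le
  have hrange' := hc.range_mark (k + 1) hk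
  rcases hc.step k hk with ⟨U, hU⟩ | ⟨D, hD⟩
  · refine hU.isFace_iff Φ σ.disjoint (fun i hi => ?_) (by simp)
    by_contra hstarted
    have running : (c (k + 1)).mark i ∈ Set.range (c k).mark :=
      hrange ▸ ⟨hσ.1 _ hstarted, (hrange'.subset ⟨i, rfl⟩).2.trans' k.le_succ⟩
    rw [hU.range_mark] at running
    exact running.2 (Or.inl hi)
  · refine (hD.isFace_iff Φ σ.disjoint (by simp) fun i hi => ?_).symm
    by_contra hunfinished
    have running : (c k).mark i ∈ Set.range (c (k + 1)).mark :=
      hrange' ▸ ⟨(hrange.subset ⟨i, rfl⟩).1.trans k.le_succ, hσ'.2 _ hunfinished⟩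
    rw [hD.range_mark] at running
    exact running.2 (Or.inr hi)

theorem isFace_iff_of_le (Φ : FaceSystem F) (hc : IsRun n b t c) {j k : ℕ} (hjk : j ≤ k)
    (hk : k ≤ n) (hj : σ.CompatibleAt b t j) (hk' : σ.CompatibleAt b t k) :
    IsFace σ.unstarted σ.done z (c j) ↔ IsFace σ.unstarted σ.done z (c k) := by
  induction k, hjk using Nat.le_induction with
  | base => rfl
  | succ k hjk ih =>
    have hσ : σ.CompatibleAt b t k :=
      ⟨fun e he => (hj.1 e he).trans hjk, fun e he => (hk'.2 e he).trans' k.le_succ⟩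
    exact (ih (Nat.le_of_succ_le hk) hσ).trans (hc.isFace_succ_iff Φ hk hσ hk')

theorem isFace_iff (Φ : FaceSystem F) (hc : IsRun n b t c) {j k : ℕ} (hj : j ≤ n) (hk : k ≤ n)
    (hσj : σ.CompatibleAt b t j) (hσk : σ.CompatibleAt b t k) :
    IsFace σ.unstarted σ.done z (c j) ↔ IsFace σ.unstarted σ.done z (c k) := by
  rcases le_total j k with hjk | hkj
  · exact hc.isFace_iff_of_le Φ hjk hk hσj hσk
  · exact (hc.isFace_iff_of_le Φ hkj hj hσk hσj).symm

end IsRun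

end Runs

/-! ### Tracks -/

section Tracks

variable {Act : Type v} {C : Type v} [Category.{0} C] {F : C ⥤ LoWord Act}
  {X : Cᵒᵖ ⥤ Type w} {P Q : Iposet Act} {x y : Cell X}

open MarkedCell

/-- A coherent choice of cells of `X` for the states of `P`, leading from `x` to `y`. It is a
relation since the cell of a state is only determined up to the identity of its object of `C`. -/
structure Track (F : C ⥤ LoWord Act) (X : Cᵒᵖ ⥤ Type w) (P : Iposet Act) (x y : Cell X) where
  At : P.State → MarkedCell F X P → Prop
  exists_at : ∀ σ, ∃ z, At σ z
  range_mark : ∀ {σ z}, At σ z → Set.range z.mark = (σ.unstarted ∪ σ.done)ᶜ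
  isFace : ∀ {σ τ z w}, At σ z → At τ w → τ.unstarted ⊆ σ.unstarted → τ.done ⊆ σ.done →
    IsFace σ.unstarted σ.done z w
  start : ∃ z, At (.start P) z ∧ z.cell = x
  finish : ∃ z, At (.finish P) z ∧ z.cell = y

/-- The cells of a run at the states of `P`: the face of the cell at any compatible time. -/
def IsRun.track (Φ : FaceSystem F) {n : ℕ} {b t : P.carrier → ℕ} {c : ℕ → MarkedCell F X P}
    (hc : IsRun n b t c) (h : P.Timing n b t) : Track F X P (c 0).cell (c n).cell where
  At σ z := ∃ k ≤ n, σ.CompatibleAt b t k ∧ IsFace σ.unstarted σ.done z (c k)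
  exists_at σ := by
    obtain ⟨k, hk, hσ⟩ := h.exists_compatibleAt σ
    obtain ⟨z, hz⟩ := hc.exists_isFace Φ h σ hk
    exact ⟨z, k, hk, hσ, hz⟩
  range_mark := fun ⟨_, hk, hσ, hz⟩ => hc.range_mark_of_isFace hk hσ hz
  isFace := by
    rintro σ τ z w ⟨j, hj, hσj, hz⟩ ⟨k, hk, hτk, hw⟩ hU hD
    have hσk : σ.CompatibleAt b t k :=
      ⟨fun e he => hτk.1 e fun h => he (hU h), fun e he => hτk.2 e fun h => he (hD h)⟩
    exact ((hc.isFace_iff Φ hj hk hσj hσk).1 hz).cancel Φ hw (Set.preimage_mono hU)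
      (Set.preimage_mono hD)
  start := by
    have mark_mem_S (i) : (c 0).mark i ∈ P.S :=
      (h.mem_S_iff _).2 (Nat.le_zero.1 ((hc.range_mark 0 n.zero_le).subset ⟨i, rfl⟩).1)
    refine ⟨c 0, ⟨0, n.zero_le, ⟨fun e he => ?_, fun e _ => (t e).zero_le⟩, ?_⟩, rfl⟩
    · exact ((h.mem_S_iff e).1 (not_not.1 he)).le
    · exact (isFace_self (c 0)).congr
        (Set.eq_empty_of_forall_notMem fun i => not_not.2 (mark_mem_S i)).symm rfl
  finish := by
    have mark_mem_T (i) : (c n).mark i ∈ P.T :=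
      (h.mem_T_iff _).2 ((h.death_le _).antisymm ((hc.range_mark n le_rfl).subset ⟨i, rfl⟩).2)
    refine ⟨c n, ⟨n, le_rfl, ⟨fun e _ => h.birth_le e, fun e he => ?_⟩, ?_⟩, rfl⟩
    · exact ((h.mem_T_iff e).1 (not_not.1 he)).ge
    · exact (isFace_self (c n)).congr rfl
        (Set.eq_empty_of_forall_notMem fun i => not_not.2 (mark_mem_T i)).symm

theorem HPath.nonempty_track (Φ : FaceSystem F) (p : HPath F X x y) :
    Nonempty (Track F X p.ev.P x y) := by
  obtain ⟨n, b, t, h, c, hc, hzero, hn⟩ := p.exists_isRun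
  have T := hc.track Φ h
  rw [hzero, hn] at T
  exact ⟨T⟩

theorem Iposet.IsSubsumption.lab_symm {f : P.carrier ≃ Q.carrier} (hf : IsSubsumption P Q f)
    (a : Q.carrier) : P.lab (f.symm a) = Q.lab a := by
  rw [← hf.lab, f.apply_symm_apply]

theorem Iposet.IsSubsumption.evt_symm {f : P.carrier ≃ Q.carrier} (hf : IsSubsumption P Q f)
    {a b : Q.carrier} (h : Q.evt a b) (hab : ¬ P.prec (f.symm a) (f.symm b))
    (hba : ¬ P.prec (f.symm b) (f.symm a)) : P.evt (f.symm a) (f.symm b) := by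
  rcases P.comparable (f.symm a) (f.symm b) with heq | hlt | hgt | hevt | hevt
  · exact (Q.evt_irrefl _ (f.symm.injective heq ▸ h)).elim
  · exact (hab hlt).elim
  · exact (hba hgt).elim
  · exact hevt
  · have hQ := hf.preserves_evt _ _ hevt hba hab
    rw [f.apply_symm_apply, f.apply_symm_apply] at hQ
    exact (Q.evt_irrefl _ (Q.evt_trans _ _ _ h hQ)).elim

namespace Track

theorem evt_symm_mark (T : Track F X Q x y) {f : P.carrier ≃ Q.carrier}
    (hf : Iposet.IsSubsumption P Q f) {σ : P.State} {w : MarkedCell F X Q}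
    (hw : T.At (σ.map hf) w) (i j) (hij : Q.evt (w.mark i) (w.mark j)) :
    P.evt (f.symm (w.mark i)) (f.symm (w.mark j)) := by
  have running (i) : f.symm (w.mark i) ∉ σ.unstarted ∧ f.symm (w.mark i) ∉ σ.done :=
    not_or.1 ((T.range_mark hw).subset ⟨i, rfl⟩)
  exact hf.evt_symm hij (σ.not_prec _ (running i).2 _ (running j).1)
    (σ.not_prec _ (running j).2 _ (running i).1)

/-- The track of `P` obtained from one of `Q` by regarding the states of `P` as states of `Q`. -/
def comap (T : Track F X Q x y) {f : P.carrier ≃ Q.carrier}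
    (hf : Iposet.IsSubsumption P Q f) : Track F X P x y where
  At σ z := ∃ w, ∃ hw : T.At (σ.map hf) w,
    z = w.map f.symm (T.evt_symm_mark hf hw) fun _ => hf.lab_symm _
  exists_at σ := by
    obtain ⟨w, hw⟩ := T.exists_at (σ.map hf)
    exact ⟨_, w, hw, rfl⟩
  range_mark := by
    rintro σ _ ⟨w, hw, rfl⟩
    refine (Set.range_comp f.symm w.mark).trans ?_
    rw [T.range_mark hw, f.symm.image_compl, Set.image_union]
    exact congrArg _ (congrArg₂ _ (f.symm.image_preimage _) (f.symm.image_preimage _))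
  isFace := by
    rintro σ τ _ _ ⟨z, hz, rfl⟩ ⟨w, hw, rfl⟩ hU hD
    have hface := (T.isFace hz hw (Set.preimage_mono hU) (Set.preimage_mono hD)).map
      f.symm.injective (zevt := T.evt_symm_mark hf hz) (zlab := fun _ => hf.lab_symm _)
      (cevt := T.evt_symm_mark hf hw) (clab := fun _ => hf.lab_symm _)
    rwa [Iposet.State.map, f.symm.image_preimage, f.symm.image_preimage] at hface
  start := by
    obtain ⟨w, hw, rfl⟩ := T.start
    rw [← Iposet.State.map_start hf] at hw
    exact ⟨_, ⟨w, hw, rfl⟩, rfl⟩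
  finish := by
    obtain ⟨w, hw, rfl⟩ := T.finish
    rw [← Iposet.State.map_finish hf] at hw
    exact ⟨_, ⟨w, hw, rfl⟩, rfl⟩

variable {T : Track F X P x y} {σ τ : P.State} {z w : MarkedCell F X P}

theorem markedStep_of_done_eq (hz : T.At σ z) (hw : T.At τ w) (hU : τ.unstarted ⊆ σ.unstarted)
    (hD : σ.done = τ.done) : MarkedStep z w := by
  have running : Disjoint (Set.range w.mark) σ.done := by
    rw [T.range_mark hw, hD, Set.disjoint_compl_left_iff_subset]
    exact Set.subset_union_right
  exact .inl ⟨_, (T.isFace hz hw hU hD.ge).congr rfl (Set.preimage_eq_empty running.symm)⟩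

theorem markedStep_of_unstarted_eq (hz : T.At σ z) (hw : T.At τ w)
    (hU : σ.unstarted = τ.unstarted) (hD : σ.done ⊆ τ.done) : MarkedStep z w := by
  have running : Disjoint (Set.range z.mark) τ.unstarted := by
    rw [T.range_mark hz, ← hU, Set.disjoint_compl_left_iff_subset]
    exact Set.subset_union_left
  exact .inr ⟨_, (T.isFace hw hz hU.le hD).congr (Set.preimage_eq_empty running.symm) rfl⟩

theorem range_mark_state {n k : ℕ} {b t : P.carrier → ℕ} (h : P.Timing n b t) {hk : k ≤ n}
    (hz : T.At (h.state hk) z) : Set.range z.mark = {e | b e ≤ k ∧ k ≤ t e} := by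
  rw [T.range_mark hz]
  ext e
  simp [Iposet.Timing.state]

theorem markedStep_state {n k : ℕ} {b t : P.carrier → ℕ} (h : P.Timing n b t)
    (hsep : ∀ e e', b e' ≠ t e + 1) {hk : k ≤ n} {hk' : k + 1 ≤ n} (hz : T.At (h.state hk) z)
    (hw : T.At (h.state hk') w) : MarkedStep z w := by
  by_cases hbirth : ∃ e', b e' = k + 1
  · obtain ⟨e', he'⟩ := hbirth
    have no_death (e) : t e ≠ k := fun he => hsep e e' (he ▸ he')
    refine markedStep_of_done_eq hz hw (fun e => k.le_succ.trans_lt) (Set.ext fun e => ?_)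
    exact (Nat.lt_succ_iff_lt_or_eq.trans (or_iff_left (no_death e))).symm
  · have no_birth (e) : k + 1 ≠ b e := fun he => hbirth ⟨e, he.symm⟩
    refine markedStep_of_unstarted_eq hz hw (Set.ext fun e => ?_) fun e he => he.trans k.lt_add_one
    exact ⟨fun he => (Nat.succ_le_of_lt he).lt_of_ne (no_birth e), k.lt_add_one.trans⟩

end Track

end Tracks

/-! ### Realizing an interval iposet -/

namespace Iposet

variable {Act : Type v} {P Q R : Iposet Act}

namespace InterfaceIso

variable (f : InterfaceIso P R)

theorem both_inl_or_both_inr {a c : f.Carrier} (hac : ¬ f.Prec a c) (hca : ¬ f.Prec c a) :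
    (∃ x y, a = f.inl x ∧ c = f.inl y) ∨ ∃ x y, a = f.inr x ∧ c = f.inr y := by
  have inr_of_mem {x} (hx : x ∈ P.T) : f.inl x = f.inr (f.toEquiv ⟨x, hx⟩) :=
    f.inl_eq_inr.2 ⟨hx, rfl⟩
  rcases f.cases a with ⟨x, rfl⟩ | ⟨x, hx, rfl⟩ <;>
    rcases f.cases c with ⟨y, rfl⟩ | ⟨y, hy, rfl⟩
  · exact .inl ⟨x, y, rfl, rfl⟩
  · by_cases hT : x ∈ P.T
    · exact .inr ⟨_, y, inr_of_mem hT, rfl⟩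
    · exact (hac (.cross hT hy)).elim
  · by_cases hT : y ∈ P.T
    · exact .inr ⟨x, _, rfl, inr_of_mem hT⟩
    · exact (hca (.cross hT hx)).elim
  · exact .inr ⟨x, y, rfl, rfl⟩

theorem elim_inr {E : Type*} {g : P.carrier → E} {h : R.carrier → E}
    (hgh : ∀ x : {x // x ∈ P.T}, h (f.toEquiv x) = g x) (y : R.carrier) :
    Sum.elim g (fun y : {y // y ∉ R.S} => h y) (f.inr y) = h y := by
  rcases f.cases (f.inr y) with ⟨x, hx⟩ | ⟨z, hz, hy⟩
  · obtain ⟨hT, rfl⟩ := f.inl_eq_inr.1 hx.symm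
    rw [hx]
    exact (hgh ⟨x, hT⟩).symm
  · obtain rfl := f.inr_injective hy
    simp [inr, hz]

end InterfaceIso

/-- `R` is, via `g`, the part of `P` that has happened by time `k`, where the events running at
time `k` form the target interface. -/
structure IsTruncation (b t : P.carrier → ℕ) (k : ℕ) (R : Iposet Act)
    (g : R.carrier → P.carrier) : Prop where
  timing : R.Timing k (b ∘ g) fun x => min k (t (g x))
  injective : Function.Injective g
  exists_eq : ∀ e, b e ≤ k → ∃ x, g x = e
  evt : ∀ x y, R.evt x y → ¬ R.prec x y → ¬ R.prec y x → P.evt (g x) (g y)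
  lab : ∀ x, P.lab (g x) = R.lab x

variable {b t : P.carrier → ℕ} {n k : ℕ}

theorem IsTruncation.iso {g : R.carrier → P.carrier} (hg : IsTruncation b t n R g)
    (h : P.Timing n b t) : R.Iso P := by
  have hbij : Function.Bijective g := ⟨hg.injective, fun e => hg.exists_eq e (h.birth_le e)⟩
  have min_eq (x) : min n (t (g x)) = t (g x) := min_eq_right (h.death_le _)
  have mem_S_iff (x) : x ∈ R.S ↔ g x ∈ P.S := (hg.timing.mem_S_iff x).trans (h.mem_S_iff _).symm
  have mem_T_iff (x) : x ∈ R.T ↔ g x ∈ P.T := by rw [hg.timing.mem_T_iff, h.mem_T_iff, min_eq]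
  have prec_iff (x y) : R.prec x y ↔ P.prec (g x) (g y) := by
    rw [hg.timing.prec_iff, h.prec_iff, min_eq, Function.comp_apply]
  refine ⟨Equiv.ofBijective g hbij, ⟨hg.lab, ?_, ?_, fun x y => (prec_iff x y).2, hg.evt⟩, prec_iff⟩
  · rw [Set.ext mem_S_iff]
    exact hbij.surjective.image_preimage P.S
  · rw [Set.ext mem_T_iff]
    exact hbij.surjective.image_preimage P.T

/-- `R` is, via `h`, the part of `P` that happens between the times `k` and `k + 1`. -/
structure IsSlice (b t : P.carrier → ℕ) (k : ℕ) (R : Iposet Act)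
    (h : R.carrier → P.carrier) : Prop where
  evt : ∀ x y, R.evt x y → P.evt (h x) (h y)
  lab : ∀ x, P.lab (h x) = R.lab x
  image_S : h '' R.S = {e | b e ≤ k ∧ k ≤ t e}
  image_T : h '' R.T = {e | b e ≤ k + 1 ∧ k + 1 ≤ t e}

namespace IsSlice

variable {h : R.carrier → P.carrier}

theorem injective (hs : IsSlice b t k R h) (hR : R.IsStarterOrTerminator) :
    Function.Injective h := by
  intro x y hxy
  rcases R.comparable x y with heq | hprec | hprec | hevt | hevt
  · exact heq
  · exact (hR.not_prec _ _ hprec).elim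
  · exact (hR.not_prec _ _ hprec).elim
  · exact (P.evt_irrefl _ (hxy ▸ hs.evt x y hevt)).elim
  · exact (P.evt_irrefl _ (hxy ▸ hs.evt y x hevt)).elim

theorem mem_S_iff (hs : IsSlice b t k R h) (hR : R.IsStarterOrTerminator) (y : R.carrier) :
    y ∈ R.S ↔ b (h y) ≤ k ∧ k ≤ t (h y) := by
  rw [← (hs.injective hR).mem_set_image, hs.image_S, Set.mem_ofPred_eq]

theorem mem_T_iff (hs : IsSlice b t k R h) (hR : R.IsStarterOrTerminator) (y : R.carrier) :
    y ∈ R.T ↔ b (h y) ≤ k + 1 ∧ k + 1 ≤ t (h y) := by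
  rw [← (hs.injective hR).mem_set_image, hs.image_T, Set.mem_ofPred_eq]

variable {f : InterfaceIso Q R} {g : f.Carrier → P.carrier}

theorem glueBirth_eq (hs : IsSlice b t k R (g ∘ f.inr)) (hR : R.IsStarterOrTerminator) :
    f.glueBirth k (b ∘ g ∘ f.inl) = b ∘ g := by
  funext a
  rcases f.cases a with ⟨x, rfl⟩ | ⟨y, hy, rfl⟩
  · rfl
  · have hS := mt (hs.mem_S_iff hR y).2 hy
    have hT := (hs.mem_T_iff hR y).1 ((hR.mem_S_or_mem_T y).resolve_left hy)
    simp only [Function.comp_apply] at hS hT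
    rw [InterfaceIso.glueBirth_inr hy, Function.comp_apply]
    omega

theorem glueDeath_eq (hs : IsSlice b t k R (g ∘ f.inr)) (hR : R.IsStarterOrTerminator)
    (hg : IsTruncation b t k Q (g ∘ f.inl)) :
    f.glueDeath k (fun x => min k (t ((g ∘ f.inl) x))) = fun a => min (k + 1) (t (g a)) := by
  funext a
  rcases f.eq_inl_or_eq_inr a with ⟨x, hx, rfl⟩ | ⟨y, rfl⟩
  · have hlt := mt (hg.timing.mem_T_iff x).2 hx
    rw [InterfaceIso.glueDeath_inl hx]
    simp only [Function.comp_apply] at hlt ⊢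
    omega
  · by_cases hy : y ∈ R.T
    · rw [InterfaceIso.glueDeath_inr_of_mem hy]
      exact (min_eq_left ((hs.mem_T_iff hR y).1 hy).2).symm
    · have hT := mt (hs.mem_T_iff hR y).2 hy
      have hS := (hs.mem_S_iff hR y).1 ((hR.mem_S_or_mem_T y).resolve_right hy)
      rw [InterfaceIso.glueDeath_inr_of_notMem (fun x => (hg.timing.mem_T_iff x).1) hy]
      simp only [Function.comp_apply] at hS hT ⊢
      omega

end IsSlice

theorem IsTruncation.glue {f : InterfaceIso Q R} {g : f.Carrier → P.carrier}
    (hg : IsTruncation b t k Q (g ∘ f.inl)) (hs : IsSlice b t k R (g ∘ f.inr))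
    (hR : R.IsStarterOrTerminator) (hbt : ∀ e, b e ≤ t e) :
    IsTruncation b t (k + 1) (Q.glue R f) g := by
  have timing : (Q.glue R f).Timing (k + 1) (b ∘ g) fun a => min (k + 1) (t (g a)) :=
    hs.glueBirth_eq hR ▸ hs.glueDeath_eq hR hg ▸ hg.timing.glue hR
  refine ⟨timing, fun a c hac => ?_, fun e he => ?_, fun a c h hac hca => ?_, fun a => ?_⟩
  · have not_prec : ¬ f.Prec a c := timing.not_prec_of_birth_eq (congrArg b hac)
    have not_prec' : ¬ f.Prec c a := timing.not_prec_of_birth_eq (congrArg b hac.symm)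
    rcases f.both_inl_or_both_inr not_prec not_prec' with ⟨x, y, rfl, rfl⟩ | ⟨x, y, rfl, rfl⟩
    · exact congrArg _ (hg.injective hac)
    · exact congrArg _ (hs.injective hR hac)
  · rcases he.lt_or_eq with hlt | heq
    · obtain ⟨x, hx⟩ := hg.exists_eq e (Nat.lt_succ_iff.1 hlt)
      exact ⟨f.inl x, hx⟩
    · obtain ⟨y, -, hy⟩ := hs.image_T.ge ⟨he, heq.symm.trans_le (hbt e)⟩
      exact ⟨f.inr y, hy⟩
  · rcases f.both_inl_or_both_inr hac hca with ⟨x, y, rfl, rfl⟩ | ⟨x, y, rfl, rfl⟩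
    · exact hg.evt x y (f.evt_inl_iff.1 h) (fun hlt => hac (.left hlt)) fun hlt => hca (.left hlt)
    · exact hs.evt x y (f.evt_inr_iff.1 h)
  · rcases f.cases a with ⟨x, rfl⟩ | ⟨y, -, rfl⟩
    · exact hg.lab x
    · exact (hs.lab y).trans (f.lab_inr y).symm

end Iposet

section Realization

variable {Act : Type v} {C : Type v} [Category.{0} C] {F : C ⥤ LoWord Act}
  {X : Cᵒᵖ ⥤ Type w} {P : Iposet Act} {x y : Cell X}
  {n k : ℕ} {b t : P.carrier → ℕ} {z w : MarkedCell F X P}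

/-- Some path from `x` to the cell of `z` has as its events the part of `P` that has happened by
time `k`, with the running events marked as in `z`. -/
def RealizesUpTo (b t : P.carrier → ℕ) (k : ℕ) (x : Cell X) (z : MarkedCell F X P) : Prop :=
  ∃ (p : HPath F X x z.cell) (g : p.ev.P.carrier → P.carrier),
    Iposet.IsTruncation b t k p.ev.P g ∧ ∀ i, g (p.ev.tgt i) = z.mark i

namespace RealizesUpTo

theorem zero (hz : Set.range z.mark = {e | b e ≤ 0 ∧ 0 ≤ t e}) :
    RealizesUpTo b t 0 z.cell z := by
  have birth_mark (i) : b (z.mark i) = 0 := Nat.le_zero.1 (hz.subset ⟨i, rfl⟩).1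
  refine ⟨.nil z.cell, ?_⟩
  rw [HPath.ev]
  refine ⟨z.mark, ⟨⟨?_, ?_, ?_, ?_, ?_⟩, z.mark_injective, ?_, ?_, z.lab_mark⟩, fun _ => rfl⟩
  · exact fun i => (birth_mark i).le
  · exact fun i => min_le_left _ _
  · exact fun i => iff_of_true trivial (birth_mark i)
  · exact fun i => iff_of_true trivial (Nat.zero_min _)
  · exact fun i j => iff_of_false not_false fun h => Nat.not_lt_zero _ (h.trans_eq (birth_mark j))
  · exact fun e he => hz.ge ⟨he, Nat.zero_le _⟩
  · exact fun i j hij _ _ => z.evt_mark i j hij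

theorem succ (hz : RealizesUpTo b t k x z) (hstep : MarkedStep z w) (hbt : ∀ e, b e ≤ t e)
    (range_z : Set.range z.mark = {e | b e ≤ k ∧ k ≤ t e})
    (range_w : Set.range w.mark = {e | b e ≤ k + 1 ∧ k + 1 ≤ t e}) :
    RealizesUpTo b t (k + 1) x w := by
  obtain ⟨p, g, hg, htgt⟩ := hz
  obtain ⟨s, h, hevt, hlab, hsrc, hmark⟩ := hstep.exists_step
  have hslice : Iposet.IsSlice b t k s.ev.P h := by
    have image_S : h '' s.ev.P.S = Set.range z.mark := by
      conv_lhs => rw [← MarkedCell.range_mark_ofSrc z.cell s.ev, ← Set.range_comp]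
      exact congrArg Set.range (funext hsrc)
    have image_T : h '' s.ev.P.T = Set.range w.mark := by
      conv_lhs => rw [← MarkedCell.range_mark_ofTgt w.cell s.ev, ← Set.range_comp]
      exact congrArg Set.range (funext hmark)
    exact ⟨hevt, hlab, image_S.trans range_z, image_T.trans range_w⟩
  let f := p.ev.interfaceIso s.ev
  have agree (u : {u // u ∈ p.ev.P.T}) : h (f.toEquiv u) = g u := by
    rw [← p.ev.tgt.apply_symm_apply u, htgt]
    exact (hsrc _).trans (congrArg _ (by simp))
  let d : f.Carrier → P.carrier := Sum.elim g fun v => h v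
  have hd : d ∘ f.inr = h := funext (f.elim_inr agree)
  refine ⟨p.snoc s, ?_⟩
  rw [HPath.ev]
  refine ⟨d, hg.glue (f := f) (g := d) (hd ▸ hslice) s.isStarterOrTerminator hbt, fun i => ?_⟩
  exact (congrFun hd _).trans (hmark i)

end RealizesUpTo

theorem Track.exists_path (T : Track F X P x y) (h : P.Timing (n + 1) b t)
    (hsep : ∀ e e', b e' ≠ t e + 1) : ∃ p : HPath F X x y, p.ev.P.Iso P := by
  have realizes (k : ℕ) (hk : k + 1 ≤ n + 1) :
      ∀ w, T.At (h.state hk) w → RealizesUpTo b t (k + 1) x w := by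
    induction k with
    | zero =>
      obtain ⟨z, hz, rfl⟩ := T.start
      rw [← h.state_zero] at hz
      exact fun w hw => (RealizesUpTo.zero (T.range_mark_state h hz)).succ
        (T.markedStep_state h hsep hz hw) h.birth_le_death (T.range_mark_state h hz)
        (T.range_mark_state h hw)
    | succ k ih =>
      obtain ⟨z, hz⟩ := T.exists_at (h.state (Nat.le_of_succ_le hk))
      exact fun w hw => (ih _ z hz).succ (T.markedStep_state h hsep hz hw) h.birth_le_death
        (T.range_mark_state h hz) (T.range_mark_state h hw)
  obtain ⟨w, hw, rfl⟩ := T.finish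
  rw [← h.state_last] at hw
  obtain ⟨p, g, hg, -⟩ := realizes n le_rfl w hw
  exact ⟨p, hg.iso h⟩

namespace Iposet.IsInterval

theorem exists_nat (hP : P.IsInterval) :
    ∃ (N : ℕ) (b t : P.carrier → ℕ), (∀ e, b e ≤ N) ∧ (∀ e, t e ≤ N) ∧
      ∀ e e', P.prec e e' ↔ t e < b e' := by
  classical
  have := P.finite
  have := Fintype.ofFinite P.carrier
  obtain ⟨β, τ, -, hβτ⟩ := hP
  let deathsBefore (r : ℝ) : Finset P.carrier := {e | τ e < r}
  have deathsBefore_mono {r s : ℝ} (hrs : r ≤ s) : deathsBefore r ⊆ deathsBefore s :=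
    Finset.monotone_filter_right _ fun _ _ he => he.trans_le hrs
  refine ⟨Fintype.card P.carrier, fun e => (deathsBefore (β e)).card,
    fun e => (deathsBefore (τ e)).card, fun e => Finset.card_le_univ _,
    fun e => Finset.card_le_univ _, fun e e' => (hβτ e e').trans ⟨fun hlt => ?_, fun hcard => ?_⟩⟩
  · refine Finset.card_lt_card ((deathsBefore_mono hlt.le).ssubset_of_mem_notMem (a := e) ?_ ?_)
    · simpa [deathsBefore] using hlt
    · simp [deathsBefore]
  · by_contra hle
    exact hcard.not_ge (Finset.card_le_card (deathsBefore_mono (not_lt.1 hle)))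

theorem exists_timing (hP : P.IsInterval) :
    ∃ n b t, P.Timing (n + 1) b t ∧ ∀ e e', b e' ≠ t e + 1 := by
  classical
  obtain ⟨N, β, τ, hβ, hτ, hβτ⟩ := hP.exists_nat
  -- Births after time `0` and deaths all happen at odd times, so no birth directly follows a death.
  let b (e : P.carrier) : ℕ := if e ∈ P.S then 0 else 2 * β e + 1
  let t (e : P.carrier) : ℕ := if e ∈ P.T then 2 * N + 3 else 2 * τ e + 1
  refine ⟨2 * N + 2, b, t, ⟨fun e => ?_, fun e => ?_, fun e => ?_, fun e => ?_, fun e e' => ?_⟩,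
    fun e e' => ?_⟩
  · have := hβ e
    grind
  · have := hτ e
    grind
  · grind
  · have := hτ e
    grind
  · have := P.T_maximal e
    have := P.S_minimal e'
    have := hβ e'
    grind
  · grind

end Iposet.IsInterval

theorem HPath.exists_iso_of_subsumed (Φ : FaceSystem F) (p : HPath F X x y) (hP : P.IsInterval)
    (hPp : P.Subsumed p.ev.P) : ∃ q : HPath F X x y, q.ev.P.Iso P := by
  obtain ⟨f, hf⟩ := hPp
  obtain ⟨T⟩ := p.nonempty_track Φ
  obtain ⟨n, b, t, h, hsep⟩ := hP.exists_timing
  exact (T.comap hf).exists_path h hsep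

theorem isLanguage_of_faceSystem (Φ : FaceSystem F) (start accept : Set (Cell X)) :
    Ipomset.IsLanguage {P : Ipomset Act | ∃ x ∈ start, ∃ y ∈ accept, ∃ p : HPath F X x y,
      Ipomset.mk p.ev.P = P} := by
  refine ⟨?_, fun P => ?_⟩
  · rintro _ ⟨x, -, y, -, p, rfl⟩
    exact p.isInterval
  · induction P using Quotient.inductionOn with | _ P
    rintro _ hP hPQ ⟨x, hx, y, hy, p, rfl⟩
    obtain ⟨q, hq⟩ := p.exists_iso_of_subsumed Φ hP hPQ
    exact ⟨x, hx, y, hy, q, Quotient.sound hq⟩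

end Realization

theorem mainTheorem6 {Act : Type v} :
    (∀ H : HDA.{v, w} Act, Ipomset.IsLanguage H.Lang) ∧
      (∀ H : IHDA.{v, w} Act, Ipomset.IsLanguage H.Lang) :=
  ⟨fun H => isLanguage_of_faceSystem (LoWord.faceSystem Act) H.start H.accept,
    fun H => isLanguage_of_faceSystem (IloWord.faceSystem Act) H.start H.accept⟩
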